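/- All graphs are finite and simple. For a graph $G$ and a nonempty set $S\subseteq V(G)$ put $P^{[0]}(S)=S$, $P^{[1]}(S)=N[S]$ (the closed neighborhood of $S$), and for $i\ge 1$ let $P^{[i+1]}(S)$ be the union of $P^{[i]}(S)$ and the set of all $w\in V(G)\setminus P^{[i]}(S)$ for which there is $u\in P^{[i]}(S)$ with $N(u)\setminus P^{[i]}(S)=\{w\}$. The set $S$ is a dominating set if $N[S]=V(G)$, and a power dominating set if every vertex lies in some $P^{[i]}(S)$. Let $\operatorname{pt}_{\rm pd}(G;S)$ be the least integer $t\ge 1$ with $P^{[t]}(S)=V(G)$, and $\infty$ if there is none. Let $\operatorname{th}_{\rm pd}^{\times}(G;S)=|S|\cdot\operatorname{pt}_{\rm pd}(G;S)$, let $\operatorname{th}_{\rm pd}^{\times}(G)$ be the minimum of $\operatorname{th}_{\rm pd}^{\times}(G;S)$ over all nonempty $S\subseteq V(G)$, and let $\gamma(G)$ be the minimum cardinality of a dominating set of $G$. Write $\Box$ for the Cartesian product of graphs, and $P_k$, $C_k$ for the path and the cycle on $k$ vertices. **Theorem.** Let $n,m\ge 4$, let $J_n\in\{P_n,C_n\}$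 and $J_m\in\{P_m,C_m\}$ (chosen independently), and let $G=J_n\Box J_m$. 1. If $S$ is a power dominating set of $G$ that is not a dominating set of $G$, then $\operatorname{th}_{\rm pd}^{\times}(G;S)\ge\left\lceil\frac{nm}{4}\right\rceil$. 2. $\operatorname{th}_{\rm pd}^{\times}(G)=\gamma(G)$. -/

import Mathlib

/-- The closed neighborhood `N[S]` of a set `S` of vertices. -/
def closedNeighborhood {V : Type*} (G : SimpleGraph V) (S : Set V) : Set V :=
  {v | v ∈ S ∨ ∃ u ∈ S, G.Adj u v}

/-- The vertices `w` outside `O` that are the only neighbor outside `O` of some `u` in `O`. -/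
def forcedVertices {V : Type*} (G : SimpleGraph V) (O : Set V) : Set V :=
  {w | w ∉ O ∧ ∃ u ∈ O, G.neighborSet u \ O = {w}}

/-- `observed G S i` is the set `P^{[i]}(S)` of vertices observed in the rounds `0, …, i`:
round `1` is the domination step, every later round is a simultaneous zero forcing step. -/
def observed {V : Type*} (G : SimpleGraph V) (S : Set V) : ℕ → Set V
  | 0 => S
  | 1 => closedNeighborhood G S
  | i + 2 => observed G S (i + 1) ∪ forcedVertices G (observed G S (i + 1))

/-- `S` dominates `G`: `N[S] = V(G)`. -/
def IsDominatingSet {V : Type*} (G : SimpleGraph V) (S : Finset V) : Prop :=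
  closedNeighborhood G (S : Set V) = Set.univ

/-- `S` is a power dominating set: every vertex is observed in some round. -/
def IsPowerDominatingSet {V : Type*} (G : SimpleGraph V) (S : Finset V) : Prop :=
  ∀ v : V, ∃ i : ℕ, v ∈ observed G (S : Set V) i

/-- The domination number `γ(G)` of a finite graph: the minimum size of a dominating set. -/
noncomputable def dominationNumber {V : Type*} [Finite V] (G : SimpleGraph V) : ℕ :=
  sInf {k : ℕ | ∃ S : Finset V, IsDominatingSet G S ∧ S.card = k}

/-- The power propagation time `pt_pd(G; S)` of a finite graph: the least positive `t` such that
all vertices are observed after round `t`; it is `⊤` if there is no such `t`, that is, if `S` is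
not a power dominating set. -/
noncomputable def powerPropagationTime {V : Type*} [Finite V] (G : SimpleGraph V)
    (S : Finset V) : ℕ∞ :=
  ⨅ (t : ℕ) (_ : 1 ≤ t ∧ observed G (S : Set V) t = Set.univ), (t : ℕ∞)

/-- `th_pd^×(G; S) = |S| · pt_pd(G; S)`. -/
noncomputable def productPowerThrottlingOf {V : Type*} [Finite V] (G : SimpleGraph V)
    (S : Finset V) : ℕ∞ :=
  (S.card : ℕ∞) * powerPropagationTime G S

/-- The product power throttling number `th_pd^×(G)`: the minimum of `th_pd^×(G; S)` over the
nonempty vertex sets `S`. The propagation process is only considered for nonempty sets; without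
this restriction the convention `0 * ⊤ = 0` would let the empty set contribute the value `0`. -/
noncomputable def productPowerThrottlingNumber {V : Type*} [Finite V] (G : SimpleGraph V) : ℕ∞ :=
  ⨅ (S : Finset V) (_ : S.Nonempty), productPowerThrottlingOf G S

/-!
Write `O i` for the set observed after round `i`, let `k = |S|`, and suppose that `O t` is
everything, where `t ≥ 2`.

*The bound `n * m ≤ 4 * k * t`.* Call an observed vertex active if it has an unobserved neighbor. A
forcing round observes at most as many vertices as there are active ones, and never increases
their number, because a vertex that forces stops being active. After the domination round there
are at most `4 * k` active vertices, so each round from the third on adds at most `4 * k` vertices.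
It remains to see that `|O 2| ≤ 8 * k` (`exists_roundTwo`). Count the vertices of `O 1 \ S` and the
vertices forced in round 2 by charging them to the vertices of `S`: a vertex `s ∈ S` receives at
most 8, and it receives 8 only if its four neighbors all force, force different vertices, and have
no other neighbor in `S`. This is impossible (`RoundTwo.not_forall_mem`). Indeed the four corners
around `s` must then be observed, since an unobserved corner would be forced from two sides; but a
corner that is observed from the vertex of `S` beyond it leaves a neighbor of `s` with nothing to
force.

*The case of equality.* If `n * m = 4 * k * t`, every `s ∈ S` is charged exactly 7, so at least
three of its four neighbors force. A local analysis shows that `S` then contains, with `s`, a whole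
zigzag of knight moves `s`, `s + (2, ±1)`, `s + (4, 0)`, … perpendicular to the direction of the
exceptional neighbor (`RoundTwo.exists_tight`). A path leaves no room for such a zigzag, so the
bound is strict for two paths. For a path on four vertices and an odd cycle of length `m` the zigzag
meets all `m` columns, whence `m ≤ k` and again the bound is strict.

*Comparison with the domination number.* For `t = 1` the set `S` dominates. For `t ≥ 2` the bound
reduces everything to finding dominating sets: with at most `⌈n * m / 4⌉` vertices in general, and
with at most `n * m / 4 + 1` vertices where the bound is strict. These are obtained by
putting blocks side by side, above all `n × 4` blocks dominated by `n` vertices, together with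
finitely many explicit dominating sets (`gridDom_path_path`, `gridDom_path_cycle`,
`gridDom_cycle_cycle`).
-/

/-! ### Active vertices and the growth of the observed set -/

/-- The vertices of `O` that have a neighbor outside `O`. -/
def activeVertices {V : Type*} (G : SimpleGraph V) (O : Set V) : Set V :=
  {u | u ∈ O ∧ ∃ w, w ∉ O ∧ G.Adj u w}

/-- A choice of one forcing vertex for each forced vertex. -/
theorem exists_forcers {V : Type*} [Finite V] (G : SimpleGraph V) (O : Set V) :
    ∃ F : Set V, F ⊆ activeVertices G O ∧ F.ncard = (forcedVertices G O).ncard ∧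
      (∀ u ∈ F, ∃ w ∈ forcedVertices G O, G.neighborSet u \ O = {w}) ∧
      (∀ u ∈ F, ∀ v ∈ F, G.neighborSet u \ O = G.neighborSet v \ O → u = v) := by
  have h : ∀ w, ∃ u, w ∈ forcedVertices G O → u ∈ O ∧ G.neighborSet u \ O = {w} := by
    intro w
    by_cases hw : w ∈ forcedVertices G O
    · obtain ⟨-, u, hu⟩ := hw
      exact ⟨u, fun _ => hu⟩
    · exact ⟨w, fun h => absurd h hw⟩
  choose f hf using h
  have key : ∀ w ∈ forcedVertices G O, ∀ w' ∈ forcedVertices G O,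
      G.neighborSet (f w) \ O = G.neighborSet (f w') \ O → w = w' := by
    intro w hw w' hw' e
    rw [(hf w hw).2, (hf w' hw').2] at e
    exact Set.singleton_injective e
  refine ⟨f '' forcedVertices G O, ?_, ?_, ?_, ?_⟩
  · rintro _ ⟨w, hw, rfl⟩
    have : w ∈ G.neighborSet (f w) \ O := by rw [(hf w hw).2]; rfl
    exact ⟨(hf w hw).1, w, this.2, this.1⟩
  · exact Set.InjOn.ncard_image fun w hw w' hw' e => key w hw w' hw' (by rw [e])
  · rintro _ ⟨w, hw, rfl⟩
    exact ⟨w, hw, (hf w hw).2⟩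
  · rintro _ ⟨w, hw, rfl⟩ _ ⟨w', hw', rfl⟩ e
    rw [key w hw w' hw' e]

theorem observed_succ {V : Type*} (G : SimpleGraph V) (S : Set V) {i : ℕ} (hi : 1 ≤ i) :
    observed G S (i + 1) = observed G S i ∪ forcedVertices G (observed G S i) := by
  obtain ⟨j, rfl⟩ := Nat.exists_eq_add_of_le' hi
  rfl

theorem ncard_union_forcedVertices {V : Type*} [Finite V] (G : SimpleGraph V) (O : Set V) :
    (O ∪ forcedVertices G O).ncard = O.ncard + (forcedVertices G O).ncard :=
  Set.ncard_union_eq (Set.disjoint_left.2 fun _ hO hw => hw.1 hO)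

theorem ncard_forcedVertices_le {V : Type*} [Finite V] (G : SimpleGraph V) (O : Set V) :
    (forcedVertices G O).ncard ≤ (activeVertices G O).ncard := by
  obtain ⟨F, hFa, hFc, -, -⟩ := exists_forcers G O
  exact hFc ▸ Set.ncard_le_ncard hFa

/-- A vertex that forces is never active again, so a forcing round replaces active vertices by at
most as many newly observed ones. -/
theorem ncard_activeVertices_step_le {V : Type*} [Finite V] (G : SimpleGraph V) (O : Set V) :
    (activeVertices G (O ∪ forcedVertices G O)).ncard ≤ (activeVertices G O).ncard := by
  obtain ⟨F, hFa, hFc, hFw, -⟩ := exists_forcers G O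
  have hsub : activeVertices G (O ∪ forcedVertices G O) ⊆
      (activeVertices G O \ F) ∪ forcedVertices G O := by
    rintro v ⟨hv, w, hw, hvw⟩
    rcases hv with hv | hv
    · refine Or.inl ⟨⟨hv, w, fun h => hw (Or.inl h), hvw⟩, fun hvF => ?_⟩
      obtain ⟨w', hw', e⟩ := hFw v hvF
      have : w ∈ G.neighborSet v \ O := ⟨hvw, fun h => hw (Or.inl h)⟩
      rw [e] at this
      exact hw (Or.inr (this ▸ hw'))
    · exact Or.inr hv
  calc _ ≤ ((activeVertices G O \ F) ∪ forcedVertices G O).ncard := Set.ncard_le_ncard hsub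
    _ ≤ (activeVertices G O \ F).ncard + F.ncard := hFc ▸ Set.ncard_union_le _ _
    _ = _ := Set.ncard_sdiff_add_ncard_of_subset hFa

theorem ncard_activeVertices_observed_le {V : Type*} [Finite V] (G : SimpleGraph V) (S : Set V)
    (i : ℕ) : (activeVertices G (observed G S (i + 1))).ncard ≤
      (activeVertices G (observed G S 1)).ncard := by
  induction i with
  | zero => exact le_rfl
  | succ i ih => exact (ncard_activeVertices_step_le G _).trans ih

theorem ncard_observed_le {V : Type*} [Finite V] (G : SimpleGraph V) (S : Set V) (i : ℕ) :
    (observed G S (i + 2)).ncard ≤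
      (observed G S 2).ncard + i * (activeVertices G (observed G S 1)).ncard := by
  induction i with
  | zero => simp
  | succ i ih =>
    rw [observed_succ G S (by omega), ncard_union_forcedVertices]
    have h1 := ncard_forcedVertices_le G (observed G S (i + 2))
    have h2 : (activeVertices G (observed G S (i + 2))).ncard ≤ _ :=
      ncard_activeVertices_observed_le G S (i + 1)
    rw [add_mul, one_mul]
    omega

/-! ### Products of graphs of maximum degree two after the domination round -/

/-- Every vertex has at most two neighbors: among any three neighbors of a vertex, two coincide. -/
def DegreeLeTwo {α : Type*} (J : SimpleGraph α) : Prop :=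
  ∀ ⦃a x y z⦄, J.Adj a x → J.Adj a y → J.Adj a z → x = y ∨ x = z ∨ y = z

theorem DegreeLeTwo.eq_or_eq {α : Type*} {J : SimpleGraph α} (hJ : DegreeLeTwo J) {a x y z : α}
    (hx : J.Adj a x) (hy : J.Adj a y) (hxy : x ≠ y) (hz : J.Adj a z) : z = x ∨ z = y := by
  rcases hJ hx hy hz with h | h | h
  · exact absurd h hxy
  · exact Or.inl h.symm
  · exact Or.inr h.symm

/-- The situation around the vertices of `S` after the domination round in a Cartesian product
`J □ K`, with subsets of the product written as relations. `O` is the closed neighborhood of `S`,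
and `F` is a set of vertices each of which forces in the next round, no two of them forcing the
same vertex, and each of which has only one neighbor in `S`. The fields on `F` are the local
consequences of this: `uniqueJ` and `uniqueK` say that a corner next to a vertex of `S` and a
vertex of `F` is not in `S`, `unobserved` that a vertex of `F` has something to force, and `corner`
that an unobserved corner would be forced from two sides. -/
structure RoundTwo {α β : Type*} (J : SimpleGraph α) (K : SimpleGraph β) (S O F : α → β → Prop) :
    Prop where
  degJ : DegreeLeTwo J
  degK : DegreeLeTwo K
  obs {a b} : S a b → O a b
  obsJ {a a' b} : S a b → J.Adj a a' → O a' b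
  obsK {a b b'} : S a b → K.Adj b b' → O a b'
  cases {a b} : O a b → S a b ∨ (∃ a', J.Adj a a' ∧ S a' b) ∨ ∃ b', K.Adj b b' ∧ S a b'
  notMem {a b} : F a b → ¬ S a b
  uniqueJ {a a' b b'} : F a' b → S a b → J.Adj a a' → K.Adj b b' → ¬ S a' b'
  uniqueK {a a' b b'} : F a b' → S a b → J.Adj a a' → K.Adj b b' → ¬ S a' b'
  unobserved {a b} : F a b → (∃ a', J.Adj a a' ∧ ¬ O a' b) ∨ ∃ b', K.Adj b b' ∧ ¬ O a b'
  corner {a a' b b'} : F a' b → F a b' → J.Adj a a' → K.Adj b b' → O a' b'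

namespace RoundTwo

variable {α β : Type*} {J : SimpleGraph α} {K : SimpleGraph β} {S O F : α → β → Prop}

theorem flip (h : RoundTwo J K S O F) :
    RoundTwo K J (fun b a => S a b) (fun b a => O a b) (fun b a => F a b) where
  degJ := h.degK
  degK := h.degJ
  obs := h.obs
  obsJ := h.obsK
  obsK := h.obsJ
  cases hO := (h.cases hO).imp id Or.symm
  notMem := h.notMem
  uniqueJ hF hS hb ha := h.uniqueK hF hS ha hb
  uniqueK hF hS hb ha := h.uniqueJ hF hS ha hb
  unobserved hF := (h.unobserved hF).symm
  corner hF hF' hb ha := h.corner hF' hF ha hb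

/-- An observed corner next to `(a, b) ∈ S` is observed from one of the two vertices beyond it. -/
theorem exists_beyond (h : RoundTwo J K S O F) {a a' : α} {b b' : β} (hS : S a b)
    (ha : J.Adj a a') (hb : K.Adj b b') (hFa : F a' b) (hFb : F a b') (hO : O a' b') :
    (∃ x, J.Adj a' x ∧ x ≠ a ∧ S x b') ∨ ∃ y, K.Adj b' y ∧ y ≠ b ∧ S a' y := by
  rcases h.cases hO with hs | ⟨x, hx, hs⟩ | ⟨y, hy, hs⟩
  · exact absurd hs (h.uniqueJ hFa hS ha hb)
  · exact Or.inl ⟨x, hx, fun e => h.notMem hFb (e ▸ hs), hs⟩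
  · exact Or.inr ⟨y, hy, fun e => h.notMem hFa (e ▸ hs), hs⟩

/-- The neighbor `(a', b)` of `(a, b) ∈ S` does not force if the corner `(a', b')` is observed from
the vertex `(x, b')` beyond it and all vertices `(a, y)` with `y` adjacent to `b` lie in `F`: then
all neighbors of `(a', b)` are observed. -/
theorem false_of_beyond (h : RoundTwo J K S O F) {a a' x : α} {b b' : β} (hS : S a b)
    (ha : J.Adj a a') (hb : K.Adj b b') (hFa : F a' b) (hFK : ∀ y, K.Adj b y → F a y)
    (hx : J.Adj a' x) (hxa : x ≠ a) (hSx : S x b') : False := by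
  rcases h.unobserved hFa with ⟨z, hz, hO⟩ | ⟨y, hy, hO⟩
  · rcases h.degJ.eq_or_eq hx ha.symm hxa hz with rfl | rfl
    · exact hO (h.obsK hSx hb.symm)
    · exact hO (h.obs hS)
  · exact hO (h.corner hFa (hFK y hy) ha hy)

/-- The neighbors of a vertex of `S` are not all in `F`. -/
theorem not_forall_mem (h : RoundTwo J K S O F) {a a' : α} {b b' : β} (hS : S a b)
    (ha : J.Adj a a') (hb : K.Adj b b') (hFJ : ∀ x, J.Adj a x → F x b)
    (hFK : ∀ y, K.Adj b y → F a y) : False := by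
  have hO := h.corner (hFJ a' ha) (hFK b' hb) ha hb
  rcases h.exists_beyond hS ha hb (hFJ a' ha) (hFK b' hb) hO with
    ⟨x, hx, hxa, hs⟩ | ⟨y, hy, hyb, hs⟩
  · exact h.false_of_beyond hS ha hb (hFJ a' ha) hFK hx hxa hs
  · exact h.flip.false_of_beyond hS hb ha (hFK b' hb) hFJ hy hyb hs

end RoundTwo

/-- The vertex `(a, b)` has four neighbors, and all of them, with the possible exception of one
neighbor in the direction of the second factor, lie in `F`. -/
def Tight {α β : Type*} (J : SimpleGraph α) (K : SimpleGraph β) (F : α → β → Prop)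
    (a : α) (b : β) : Prop :=
  (∃ a₁ a₂, a₁ ≠ a₂ ∧ J.Adj a a₁ ∧ J.Adj a a₂) ∧ (∀ x, J.Adj a x → F x b) ∧
    ∃ b₁ b₂, b₁ ≠ b₂ ∧ K.Adj b b₁ ∧ K.Adj b b₂ ∧ F a b₂

namespace RoundTwo

variable {α β : Type*} {J : SimpleGraph α} {K : SimpleGraph β} {S O F : α → β → Prop}

/-- If the neighbors of `(a, b) ∈ S` other than `(a, b₁)` lie in `F`, then the two corners next to
`(a, b₂)` are observed from a knight move away, and those next to `(a, b₁)` are unobserved. -/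
theorem exists_knight (h : RoundTwo J K S O F) {a a₁ : α} {b b₁ b₂ : β} (hS : S a b)
    (hFJ : ∀ x, J.Adj a x → F x b) (hb : b₁ ≠ b₂) (hb₁ : K.Adj b b₁) (hb₂ : K.Adj b b₂)
    (hF : F a b₂) (ha : J.Adj a a₁) :
    (∃ x, J.Adj a₁ x ∧ x ≠ a ∧ S x b₂) ∧ ¬ O a₁ b₁ := by
  -- `(a, b₂)` is left with forcing the vertex `(a, y)` straight ahead
  have hO : ∀ x, J.Adj a x → O x b₂ := fun x hx => h.corner (hFJ x hx) hF hx hb₂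
  obtain ⟨y, hy, hyO⟩ : ∃ y, K.Adj b₂ y ∧ ¬ O a y := by
    rcases h.unobserved hF with ⟨x, hx, hxO⟩ | hy
    · exact absurd (hO x hx) hxO
    · exact hy
  have hyb : y ≠ b := fun e => hyO (e ▸ h.obs hS)
  have hx : ∃ x, J.Adj a₁ x ∧ x ≠ a ∧ S x b₂ := by
    rcases h.exists_beyond hS ha hb₂ (hFJ a₁ ha) hF (hO a₁ ha) with hx | ⟨z, hz, hzb, hs⟩
    · exact hx
    · rcases h.degK.eq_or_eq hy hb₂.symm hyb hz with rfl | rfl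
      · exact absurd (h.obsJ hs ha.symm) hyO
      · exact absurd rfl hzb
  refine ⟨hx, ?_⟩
  obtain ⟨x, hx, hxa, hs⟩ := hx
  rcases h.unobserved (hFJ a₁ ha) with ⟨z, hz, hzO⟩ | ⟨z, hz, hzO⟩
  · rcases h.degJ.eq_or_eq hx ha.symm hxa hz with rfl | rfl
    · exact absurd (h.obsK hs hb₂.symm) hzO
    · exact absurd (h.obs hS) hzO
  · rcases h.degK.eq_or_eq hb₁ hb₂ hb hz with rfl | rfl
    · exact hzO
    · exact absurd (hO a₁ ha) hzO

/-- If all vertices of `S` are tight, those that are tight in a given direction continue in both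
perpendicular directions as a zigzag of knight moves. -/
theorem exists_tight (h : RoundTwo J K S O F)
    (hT : ∀ a b, S a b → Tight J K F a b ∨ Tight K J (fun b a => F a b) b a) {a a₁ : α} {b : β}
    (hS : S a b) (hab : Tight J K F a b) (ha : J.Adj a a₁) :
    ∃ x, J.Adj a₁ x ∧ x ≠ a ∧ ∃ y, S x y ∧ Tight J K F x y := by
  obtain ⟨-, hFJ, b₁, b₂, hb, hb₁, hb₂, hF⟩ := hab
  obtain ⟨⟨x, hx, hxa, hs⟩, hO⟩ := h.exists_knight hS hFJ hb hb₁ hb₂ hF ha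
  refine ⟨x, hx, hxa, b₂, hs, (hT x b₂ hs).resolve_right ?_⟩
  -- otherwise the corners of `(x, b₂)` next to `(x₁, b₂)` would be unobserved, and `S` would
  -- contain a knight move from `(x, b₂)` past `x₂`; one of the two contradicts the situation at
  -- `(a, b)`
  rintro ⟨-, hFK, x₁, x₂, hx12, hx₁, hx₂, hF'⟩
  obtain ⟨⟨z, hz, hzb, hsz⟩, hO'⟩ := h.flip.exists_knight hs hFK hx12 hx₁ hx₂ hF' hb₂.symm
  rcases h.degJ.eq_or_eq hx₁ hx₂ hx12 hx.symm with rfl | rfl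
  · exact hO' (h.obsJ hS ha)
  · rcases h.degK.eq_or_eq hb₁ hb₂ hb hz with rfl | rfl
    · exact hO (h.obs hsz)
    · exact hzb rfl

end RoundTwo

/-! ### The count for the second round -/

open Classical in
theorem card_filter_boxProd_adj {α β : Type*} [Fintype α] [Fintype β] (J : SimpleGraph α)
    (K : SimpleGraph β) (X : Finset (α × β)) (a : α) (b : β) :
    (X.filter fun u => (J.boxProd K).Adj (a, b) u).card =
      (Finset.univ.filter fun x => J.Adj a x ∧ (x, b) ∈ X).card +
        (Finset.univ.filter fun y => K.Adj b y ∧ (a, y) ∈ X).card := by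
  have e : (X.filter fun u => (J.boxProd K).Adj (a, b) u) =
      (Finset.univ.filter fun x => J.Adj a x ∧ (x, b) ∈ X).image (fun x => (x, b)) ∪
        (Finset.univ.filter fun y => K.Adj b y ∧ (a, y) ∈ X).image (fun y => (a, y)) := by
    ext ⟨x, y⟩
    simp only [Finset.mem_filter, SimpleGraph.boxProd_adj, Finset.mem_union, Finset.mem_image,
      Finset.mem_univ, true_and, Prod.mk.injEq]
    constructor
    · rintro ⟨hX, ⟨hx, rfl⟩ | ⟨hy, rfl⟩⟩
      · exact Or.inl ⟨x, ⟨hx, hX⟩, rfl, rfl⟩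
      · exact Or.inr ⟨y, ⟨hy, hX⟩, rfl, rfl⟩
    · rintro (⟨x', ⟨hx, hX⟩, rfl, rfl⟩ | ⟨y', ⟨hy, hX⟩, rfl, rfl⟩)
      · exact ⟨hX, Or.inl ⟨hx, rfl⟩⟩
      · exact ⟨hX, Or.inr ⟨hy, rfl⟩⟩
  rw [e, Finset.card_union_of_disjoint, Finset.card_image_of_injective,
    Finset.card_image_of_injective]
  · intro y y' h; simpa using h
  · intro x x' h; simpa using h
  · rw [Finset.disjoint_left]
    intro p hp hp'
    simp only [Finset.mem_image, Finset.mem_filter, Finset.mem_univ, true_and] at hp hp'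
    obtain ⟨x, ⟨hx, -⟩, rfl⟩ := hp
    obtain ⟨y, -, hy⟩ := hp'
    rw [Prod.mk.injEq] at hy
    exact hx.ne hy.1

theorem DegreeLeTwo.card_filter_le {α : Type*} [Fintype α] {J : SimpleGraph α}
    (hJ : DegreeLeTwo J) (a : α) (p : α → Prop) [DecidablePred fun x => J.Adj a x ∧ p x] :
    (Finset.univ.filter fun x => J.Adj a x ∧ p x).card ≤ 2 := by
  by_contra! h
  obtain ⟨x, hx, y, hy, z, hz, hxy, hxz, hyz⟩ := Finset.two_lt_card.1 h
  simp only [Finset.mem_filter, Finset.mem_univ, true_and] at hx hy hz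
  rcases hJ hx.1 hy.1 hz.1 with h | h | h <;> contradiction

theorem DegreeLeTwo.forall_of_two_le_card {α : Type*} [Fintype α] {J : SimpleGraph α}
    (hJ : DegreeLeTwo J) {a : α} {p : α → Prop} [DecidablePred fun x => J.Adj a x ∧ p x]
    (h : 2 ≤ (Finset.univ.filter fun x => J.Adj a x ∧ p x).card) :
    (∃ a₁ a₂, a₁ ≠ a₂ ∧ J.Adj a a₁ ∧ J.Adj a a₂) ∧ ∀ x, J.Adj a x → p x := by
  obtain ⟨x, hx, y, hy, hxy⟩ := Finset.one_lt_card.1 h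
  simp only [Finset.mem_filter, Finset.mem_univ, true_and] at hx hy
  refine ⟨⟨x, y, hxy, hx.1, hy.1⟩, fun z hz => ?_⟩
  rcases hJ.eq_or_eq hx.1 hy.1 hxy hz with rfl | rfl
  · exact hx.2
  · exact hy.2

theorem exists_pair_of_exists {α : Type*} {J : SimpleGraph α} {a d : α} {p : α → Prop}
    (h : ∃ a₁ a₂, a₁ ≠ a₂ ∧ J.Adj a a₁ ∧ J.Adj a a₂) (hd : J.Adj a d) (hp : p d) :
    ∃ a₁ a₂, a₁ ≠ a₂ ∧ J.Adj a a₁ ∧ J.Adj a a₂ ∧ p a₂ := by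
  obtain ⟨a₁, a₂, hne, h₁, h₂⟩ := h
  by_cases e : a₁ = d
  · exact ⟨a₂, a₁, hne.symm, h₂, h₁, e ▸ hp⟩
  · exact ⟨a₁, d, e, h₁, hd, hp⟩

open Classical in
/-- The number of neighbors of `(a, b) ∈ S` in a superset `A` of `F`, plus the number of its
neighbors in `F`, is at most 7, and it is 7 only if `(a, b)` is tight in one of the directions. -/
theorem RoundTwo.card_le_seven {α β : Type*} [Fintype α] [Fintype β] {J : SimpleGraph α}
    {K : SimpleGraph β} {S O F A : α → β → Prop} (h : RoundTwo J K S O F)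
    (hFA : ∀ a b, F a b → A a b) {a : α} {b : β} (hS : S a b) :
    let c := (Finset.univ.filter fun x => J.Adj a x ∧ A x b).card +
      (Finset.univ.filter fun y => K.Adj b y ∧ A a y).card +
      ((Finset.univ.filter fun x => J.Adj a x ∧ F x b).card +
      (Finset.univ.filter fun y => K.Adj b y ∧ F a y).card)
    c ≤ 7 ∧ (c = 7 → Tight J K F a b ∨ Tight K J (fun b a => F a b) b a) := by
  have g1 := h.degJ.card_filter_le a fun x => A x b
  have g2 := h.degK.card_filter_le b fun y => A a y
  have f1 := h.degJ.card_filter_le a fun x => F x b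
  have f2 := h.degK.card_filter_le b fun y => F a y
  intro c
  refine ⟨?_, fun hc => ?_⟩
  · by_contra! hc
    have t1 := h.degJ.forall_of_two_le_card (a := a) (p := fun x => F x b) (by omega)
    have t2 := h.degK.forall_of_two_le_card (a := b) (p := fun y => F a y) (by omega)
    obtain ⟨⟨a₁, -, -, ha, -⟩, hFJ⟩ := t1
    obtain ⟨⟨b₁, -, -, hb, -⟩, hFK⟩ := t2
    exact h.not_forall_mem hS ha hb hFJ hFK
  · have f1' : (Finset.univ.filter fun x => J.Adj a x ∧ F x b).card ≤
        (Finset.univ.filter fun x => J.Adj a x ∧ A x b).card :=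
      Finset.card_le_card (Finset.monotone_filter_right _ fun x _ hx => ⟨hx.1, hFA _ _ hx.2⟩)
    have f2' : (Finset.univ.filter fun y => K.Adj b y ∧ F a y).card ≤
        (Finset.univ.filter fun y => K.Adj b y ∧ A a y).card :=
      Finset.card_le_card (Finset.monotone_filter_right _ fun y _ hy => ⟨hy.1, hFA _ _ hy.2⟩)
    obtain ⟨t1, -⟩ := h.degJ.forall_of_two_le_card (a := a) (p := fun x => A x b) (by omega)
    obtain ⟨t2, -⟩ := h.degK.forall_of_two_le_card (a := b) (p := fun y => A a y) (by omega)
    rcases Nat.lt_or_ge (Finset.univ.filter fun x => J.Adj a x ∧ F x b).card 2 with hlt | hge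
    · obtain ⟨-, hK⟩ := h.degK.forall_of_two_le_card (a := b) (p := fun y => F a y) (by omega)
      obtain ⟨d, hd⟩ := Finset.card_pos.1
        (show 0 < (Finset.univ.filter fun x => J.Adj a x ∧ F x b).card by omega)
      simp only [Finset.mem_filter, Finset.mem_univ, true_and] at hd
      exact Or.inr ⟨t2, hK, exists_pair_of_exists t1 hd.1 hd.2⟩
    · obtain ⟨-, hJ⟩ := h.degJ.forall_of_two_le_card (a := a) (p := fun x => F x b) (by omega)
      obtain ⟨d, hd⟩ := Finset.card_pos.1
        (show 0 < (Finset.univ.filter fun y => K.Adj b y ∧ F a y).card by omega)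
      simp only [Finset.mem_filter, Finset.mem_univ, true_and] at hd
      exact Or.inl ⟨t1, hJ, exists_pair_of_exists t2 hd.1 hd.2⟩

open Classical in
/-- At most `8 * |S|` vertices are observed up to round 2, and all vertices of `S` are tight in case
of equality. -/
theorem exists_roundTwo {α β : Type*} [Fintype α] [Fintype β] {J : SimpleGraph α}
    {K : SimpleGraph β} (hJ : DegreeLeTwo J) (hK : DegreeLeTwo K) (S : Finset (α × β)) :
    ∃ F : α → β → Prop, RoundTwo J K (fun a b => (a, b) ∈ S)
      (fun a b => (a, b) ∈ observed (J.boxProd K) (S : Set (α × β)) 1) F ∧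
      (observed (J.boxProd K) (S : Set (α × β)) 2).ncard ≤ 8 * S.card ∧
      ((observed (J.boxProd K) (S : Set (α × β)) 2).ncard = 8 * S.card →
        ∀ a b, (a, b) ∈ S → Tight J K F a b ∨ Tight K J (fun b a => F a b) b a) := by
  set G := J.boxProd K with hG
  set O := observed G (S : Set (α × β)) 1 with hO
  have memO : ∀ v, v ∈ O ↔ v ∈ S ∨ ∃ u ∈ S, G.Adj u v := fun v => Iff.rfl
  obtain ⟨F₀, hFa, hFc, hFw, hFi⟩ := exists_forcers G O
  have hFS : ∀ u ∈ F₀, u ∈ O ∧ u ∉ S := by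
    intro u hu
    obtain ⟨huO, w, hw, huw⟩ := hFa hu
    exact ⟨huO, fun hS => hw ((memO w).2 (Or.inr ⟨u, hS, huw⟩))⟩
  -- the chosen forcing vertices that have only one neighbor in `S`
  let F : Set (α × β) := {u | u ∈ F₀ ∧ ∀ p ∈ S, ∀ q ∈ S, G.Adj u p → G.Adj u q → p = q}
  have hR : RoundTwo J K (fun a b => (a, b) ∈ S) (fun a b => (a, b) ∈ O)
      (fun a b => (a, b) ∈ F) := by
    refine ⟨hJ, hK, fun h => Or.inl h, ?_, ?_, ?_, fun h => (hFS _ h.1).2, ?_, ?_, ?_, ?_⟩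
    · exact fun {a a' b} h ha => Or.inr ⟨(a, b), h, by simp [hG, SimpleGraph.boxProd_adj, ha]⟩
    · exact fun {a b b'} h hb => Or.inr ⟨(a, b), h, by simp [hG, SimpleGraph.boxProd_adj, hb]⟩
    · rintro a b (h | ⟨⟨x, y⟩, hu, huv⟩)
      · exact Or.inl h
      · rw [hG, SimpleGraph.boxProd_adj] at huv
        rcases huv with ⟨h1, h2⟩ | ⟨h1, h2⟩
        · simp only at h1 h2
          subst h2
          exact Or.inr (Or.inl ⟨x, h1.symm, hu⟩)
        · simp only at h1 h2
          subst h2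
          exact Or.inr (Or.inr ⟨y, h1.symm, hu⟩)
    · intro a a' b b' hF hS ha hb hS'
      have := hF.2 _ hS _ hS' (by simp [hG, SimpleGraph.boxProd_adj, ha.symm])
        (by simp [hG, SimpleGraph.boxProd_adj, hb])
      exact ha.ne (congrArg Prod.fst this)
    · intro a a' b b' hF hS ha hb hS'
      have := hF.2 _ hS _ hS' (by simp [hG, SimpleGraph.boxProd_adj, hb.symm])
        (by simp [hG, SimpleGraph.boxProd_adj, ha])
      exact ha.ne (congrArg Prod.fst this)
    · intro a b hF
      obtain ⟨-, ⟨x, y⟩, hw, huw⟩ := hFa hF.1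
      rw [hG, SimpleGraph.boxProd_adj] at huw
      rcases huw with ⟨h1, h2⟩ | ⟨h1, h2⟩
      · simp only at h1 h2
        subst h2
        exact Or.inl ⟨x, h1, hw⟩
      · simp only at h1 h2
        subst h2
        exact Or.inr ⟨y, h1, hw⟩
    · intro a a' b b' hF hF' ha hb
      by_contra hc
      have h1 : (a', b') ∈ G.neighborSet (a', b) \ O :=
        ⟨by simp [hG, SimpleGraph.boxProd_adj, hb], hc⟩
      have h2 : (a', b') ∈ G.neighborSet (a, b') \ O :=
        ⟨by simp [hG, SimpleGraph.boxProd_adj, ha], hc⟩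
      obtain ⟨w, -, e⟩ := hFw _ hF.1
      obtain ⟨w', -, e'⟩ := hFw _ hF'.1
      have := hFi _ hF.1 _ hF'.1 (by
        rw [e] at h1 ⊢; rw [e'] at h2 ⊢
        rw [← Set.mem_singleton_iff.1 h1, ← Set.mem_singleton_iff.1 h2])
      exact ha.ne (congrArg Prod.fst this).symm
  let A : Finset (α × β) := Finset.univ.filter fun u => u ∈ O ∧ u ∉ S
  have hFA : ∀ a b, (a, b) ∈ F → (a, b) ∈ A := fun a b h => by
    simpa [A] using hFS _ h.1
  have hbound := fun a b (h : (a, b) ∈ S) =>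
    hR.card_le_seven (A := fun a b => (a, b) ∈ A) hFA h
  let d : α × β → ℕ := fun u => (S.filter fun s => G.Adj s u).card
  -- double counting of the edges between `S` and its neighborhood
  have hcount : ∀ X : Finset (α × β), ∑ s ∈ S, (X.filter fun u => G.Adj s u).card =
      ∑ u ∈ X, d u := fun X =>
    Finset.sum_card_bipartiteAbove_eq_sum_card_bipartiteBelow (fun s u => G.Adj s u)
  have hO2 : (observed G (S : Set (α × β)) 2).ncard = S.card + A.card + F₀.ncard := by
    have h1 := ncard_union_forcedVertices G O
    have h2 : O.ncard = S.card + A.card := by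
      rw [← Finset.card_union_of_disjoint, ← Set.ncard_coe_finset]
      · congr 1
        ext v
        simp only [A, Finset.coe_union, Finset.coe_filter, Finset.mem_univ, true_and,
          Set.mem_union, Finset.mem_coe, Set.mem_ofPred_eq]
        exact ⟨fun h => (Classical.em (v ∈ S)).imp id fun h' => ⟨h, h'⟩,
          fun h => h.elim (fun h => (memO v).2 (Or.inl h)) And.left⟩
      · rw [Finset.disjoint_left]
        intro v hv hv'
        simp [A, hv] at hv'
    rw [hFc, ← h2]
    exact h1
  let Ff : Finset (α × β) := Finset.univ.filter fun u => u ∈ F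
  let Fs : Finset (α × β) := Finset.univ.filter fun u => u ∈ F₀ ∧ u ∉ F
  have hF0 : F₀.ncard = Ff.card + Fs.card := by
    rw [← Finset.card_union_of_disjoint, ← Set.ncard_coe_finset]
    · congr 1
      ext v
      simp only [Ff, Fs, Finset.coe_union, Finset.coe_filter, Finset.mem_univ, true_and,
          Set.mem_union, Set.mem_ofPred_eq]
      have : v ∈ F → v ∈ F₀ := fun h => h.1
      tauto
    · rw [Finset.disjoint_left]
      intro v hv hv'
      simp only [Ff, Fs, Finset.mem_filter, Finset.mem_univ, true_and] at hv hv'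
      exact hv'.2 hv
  have hd1 : ∀ u ∈ A, 1 ≤ d u := by
    intro u hu
    simp only [A, Finset.mem_filter, Finset.mem_univ, true_and] at hu
    obtain ⟨s, hs, hsu⟩ := ((memO u).1 hu.1).resolve_left hu.2
    exact Finset.card_pos.2 ⟨s, Finset.mem_filter.2 ⟨hs, hsu⟩⟩
  have hd2 : ∀ u ∈ Fs, 2 ≤ d u := by
    intro u hu
    simp only [Fs, Finset.mem_filter, Finset.mem_univ, true_and] at hu
    have : ∃ p ∈ S, ∃ q ∈ S, G.Adj u p ∧ G.Adj u q ∧ p ≠ q := by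
      by_contra! hc
      exact hu.2 ⟨hu.1, hc⟩
    obtain ⟨p, hp, q, hq, hup, huq, hpq⟩ := this
    exact Finset.one_lt_card.2 ⟨p, Finset.mem_filter.2 ⟨hp, hup.symm⟩, q,
      Finset.mem_filter.2 ⟨hq, huq.symm⟩, hpq⟩
  have hFsA : Fs ⊆ A := by
    intro u hu
    simp only [Fs, Finset.mem_filter, Finset.mem_univ, true_and] at hu
    simpa [A] using hFS _ hu.1
  -- a forcing vertex outside `F` pays for both itself and the vertex it forces, since it has two
  -- neighbors in `S`
  have hsA : A.card + Fs.card ≤ ∑ u ∈ A, d u := by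
    rw [← Finset.sum_sdiff hFsA, ← Finset.card_sdiff_add_card_eq_card hFsA]
    have h1 : (A \ Fs).card • 1 ≤ ∑ u ∈ A \ Fs, d u :=
      Finset.card_nsmul_le_sum _ _ _ fun u hu => hd1 u (Finset.mem_sdiff.1 hu).1
    have h2 : Fs.card • 2 ≤ ∑ u ∈ Fs, d u := Finset.card_nsmul_le_sum _ _ _ hd2
    simp only [smul_eq_mul] at h1 h2
    omega
  have hsF : Ff.card ≤ ∑ u ∈ Ff, d u := by
    have h1 : Ff.card • 1 ≤ ∑ u ∈ Ff, d u := Finset.card_nsmul_le_sum _ _ _ fun u hu => by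
      simp only [Ff, Finset.mem_filter, Finset.mem_univ, true_and] at hu
      exact hd1 u (hFA u.1 u.2 hu)
    simpa using h1
  rw [← hcount] at hsA hsF
  let c : α × β → ℕ := fun s => (A.filter fun u => G.Adj s u).card +
    (Ff.filter fun u => G.Adj s u).card
  have hc : ∀ s ∈ S, c s ≤ 7 ∧ (c s = 7 →
      Tight J K (fun a b => (a, b) ∈ F) s.1 s.2 ∨ Tight K J (fun b a => (a, b) ∈ F) s.2 s.1) := by
    rintro ⟨a, b⟩ hs
    have := hbound a b hs
    simp only [c, hG, card_filter_boxProd_adj]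
    have hFf : ∀ u, u ∈ Ff ↔ u ∈ F := fun u => by simp [Ff]
    simp only [hFf]
    convert this
  have hsum : ∑ s ∈ S, c s = ∑ s ∈ S, (A.filter fun u => G.Adj s u).card +
    ∑ s ∈ S, (Ff.filter fun u => G.Adj s u).card := Finset.sum_add_distrib
  have hle : ∑ s ∈ S, c s ≤ ∑ s ∈ S, 7 := Finset.sum_le_sum fun s hs => (hc s hs).1
  have h7 : ∑ s ∈ S, 7 = 7 * S.card := by simp [mul_comm]
  refine ⟨fun a b => (a, b) ∈ F, hR, by omega, fun he a b hs => ?_⟩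
  refine (hc (a, b) hs).2 ?_
  exact (Finset.sum_eq_sum_iff_of_le fun s hs => (hc s hs).1).1 (by omega) (a, b) hs

/-! ### The bound `n * m ≤ 4 * |S| * t` -/

open Classical in
theorem ncard_activeVertices_boxProd_le {α β : Type*} [Fintype α] [Fintype β]
    {J : SimpleGraph α} {K : SimpleGraph β} (hJ : DegreeLeTwo J) (hK : DegreeLeTwo K)
    (S : Finset (α × β)) :
    (activeVertices (J.boxProd K) (observed (J.boxProd K) (S : Set (α × β)) 1)).ncard ≤
      S.card * 4 := by
  have hsub : activeVertices (J.boxProd K) (observed (J.boxProd K) (S : Set (α × β)) 1) ⊆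
      ((S.biUnion fun s => Finset.univ.filter fun u => (J.boxProd K).Adj s u : Finset (α × β)) :
        Set (α × β)) := by
    rintro v ⟨hv, w, hw, hvw⟩
    rcases hv with hv | ⟨u, hu, huv⟩
    · exact absurd (Or.inr ⟨v, hv, hvw⟩) hw
    · simp only [Finset.coe_biUnion, Set.mem_iUnion]
      exact ⟨u, hu, by simpa using huv⟩
  refine (Set.ncard_le_ncard hsub (Finset.finite_toSet _)).trans ?_
  rw [Set.ncard_coe_finset]
  refine Finset.card_biUnion_le_card_mul _ _ _ fun s _ => ?_
  have h := card_filter_boxProd_adj J K Finset.univ s.1 s.2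
  have h1 := hJ.card_filter_le s.1 fun x => (x, s.2) ∈ Finset.univ
  have h2 := hK.card_filter_le s.2 fun y => (s.1, y) ∈ Finset.univ
  simp only [Prod.mk.eta] at h
  omega

/-- The basic bound, together with the rigidity of the case of equality. -/
theorem card_mul_card_le {α β : Type*} [Fintype α] [Fintype β] {J : SimpleGraph α}
    {K : SimpleGraph β} (hJ : DegreeLeTwo J) (hK : DegreeLeTwo K) (S : Finset (α × β)) {t : ℕ}
    (ht : 2 ≤ t) (hS : observed (J.boxProd K) (S : Set (α × β)) t = Set.univ) :
    Fintype.card α * Fintype.card β ≤ 4 * (S.card * t) ∧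
      (Fintype.card α * Fintype.card β = 4 * (S.card * t) →
        ∃ F : α → β → Prop, RoundTwo J K (fun a b => (a, b) ∈ S)
          (fun a b => (a, b) ∈ observed (J.boxProd K) (S : Set (α × β)) 1) F ∧
          ∀ a b, (a, b) ∈ S → Tight J K F a b ∨ Tight K J (fun b a => F a b) b a) := by
  obtain ⟨F, hF, h8, hT⟩ := exists_roundTwo hJ hK S
  obtain ⟨i, rfl⟩ := Nat.exists_eq_add_of_le' ht
  have h1 := ncard_observed_le (J.boxProd K) (S : Set (α × β)) i
  have h2 := Nat.mul_le_mul_left i (ncard_activeVertices_boxProd_le hJ hK S)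
  rw [hS, Set.ncard_univ, Nat.card_eq_fintype_card, Fintype.card_prod] at h1
  have h3 : 4 * (S.card * (i + 2)) = 8 * S.card + i * (S.card * 4) := by ring
  refine ⟨by omega, fun he => ⟨F, hF, hT (by omega)⟩⟩

theorem pathGraph_adj_iff {n : ℕ} {u v : Fin n} :
    (SimpleGraph.pathGraph n).Adj u v ↔ u.val + 1 = v.val ∨ v.val + 1 = u.val :=
  SimpleGraph.pathGraph_adj

theorem cycleGraph_adj_iff {n : ℕ} (hn : 3 ≤ n) {u v : Fin n} :
    (SimpleGraph.cycleGraph n).Adj u v ↔ u.val + 1 = v.val ∨ v.val + 1 = u.val ∨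
      (u.val = 0 ∧ v.val + 1 = n) ∨ (v.val = 0 ∧ u.val + 1 = n) := by
  have hu := u.isLt
  have hv := v.isLt
  have key : ∀ x y : ℕ, x < n → y < n →
      ((n - y + x) % n = 1 ↔ y + 1 = x ∨ (x = 0 ∧ y + 1 = n)) := by
    intro x y hx hy
    rcases Nat.lt_or_ge x y with h | h
    · rw [Nat.mod_eq_of_lt (by omega)]; omega
    · rw [show n - y + x = (x - y) + n by omega, Nat.add_mod_right, Nat.mod_eq_of_lt (by omega)]
      omega
  rw [SimpleGraph.cycleGraph_adj', Fin.sub_def, Fin.sub_def]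
  simp only [key _ _ hu hv, key _ _ hv hu]
  omega

theorem degreeLeTwo_pathGraph (n : ℕ) : DegreeLeTwo (SimpleGraph.pathGraph n) := by
  intro a x y z hx hy hz
  rw [pathGraph_adj_iff] at hx hy hz
  simp only [Fin.ext_iff]
  omega

theorem degreeLeTwo_cycleGraph {n : ℕ} (hn : 3 ≤ n) : DegreeLeTwo (SimpleGraph.cycleGraph n) := by
  intro a x y z hx hy hz
  rw [cycleGraph_adj_iff hn] at hx hy hz
  simp only [Fin.ext_iff]
  omega

/-! ### Strictness of the bound -/

/-- On a path, the zigzag through a tight vertex would run past the end. -/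
theorem RoundTwo.not_tight_of_path {n : ℕ} {β : Type*} {K : SimpleGraph β}
    {S O F : Fin n → β → Prop} (h : RoundTwo (SimpleGraph.pathGraph n) K S O F)
    (hT : ∀ a b, S a b → Tight (SimpleGraph.pathGraph n) K F a b ∨
      Tight K (SimpleGraph.pathGraph n) (fun b a => F a b) b a) (k : ℕ) :
    ∀ a b, n - a.val = k → S a b → ¬ Tight (SimpleGraph.pathGraph n) K F a b := by
  induction k using Nat.strong_induction_on with
  | _ k ih =>
    intro a b hk hS hab
    obtain ⟨a₁, ha, hlt⟩ : ∃ a₁, (SimpleGraph.pathGraph n).Adj a a₁ ∧ a.val < a₁.val := by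
      obtain ⟨⟨x, y, hne, hx, hy⟩, -, -⟩ := hab
      have hx' := pathGraph_adj_iff.1 hx
      have hy' := pathGraph_adj_iff.1 hy
      rw [Ne, Fin.ext_iff] at hne
      by_cases hxa : a.val < x.val
      · exact ⟨x, hx, hxa⟩
      · exact ⟨y, hy, by omega⟩
    obtain ⟨x, hx, hxa, y, hs, ht⟩ := h.exists_tight hT hS hab ha
    rw [pathGraph_adj_iff] at ha hx
    rw [Ne, Fin.ext_iff] at hxa
    have := x.isLt
    exact ih (n - x.val) (by omega) x y rfl hs ht

/-- If all vertices of `S` are tight in the direction of `J`, the zigzag along an odd cycle meets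
every column. -/
theorem RoundTwo.column_of_cycle {m : ℕ} (hm : 3 ≤ m) (hodd : Odd m) {α : Type*}
    {J : SimpleGraph α} {S O F : α → Fin m → Prop}
    (h : RoundTwo J (SimpleGraph.cycleGraph m) S O F)
    (hT : ∀ a b, S a b → Tight (SimpleGraph.cycleGraph m) J (fun b a => F a b) b a)
    {a : α} {b : Fin m} (hS : S a b) (c : Fin m) : ∃ x, S x c := by
  have step : ∀ c : ℕ, (∃ x, ∃ y : Fin m, y.val = c % m ∧ S x y) →
      ∃ x, ∃ y : Fin m, y.val = (c + 2) % m ∧ S x y := by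
    rintro c ⟨x, y, hy, hs⟩
    have hadd : ∀ d, (c + d) % m = (y.val + d) % m := fun d => by
      rw [hy, Nat.mod_add_mod]
    have hyl := y.isLt
    have hmod : ∀ d, d < m → (y.val + d) % m = y.val + d ∧ y.val + d < m ∨
        (y.val + d) % m = y.val + d - m ∧ m ≤ y.val + d := fun d hd => by
      rcases Nat.lt_or_ge (y.val + d) m with hlt | hge
      · exact Or.inl ⟨Nat.mod_eq_of_lt hlt, hlt⟩
      · exact Or.inr ⟨by rw [Nat.mod_eq_sub_mod hge, Nat.mod_eq_of_lt (by omega)], hge⟩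
    have h1 := hmod 1 (by omega)
    have h2 := hmod 2 (by omega)
    have h1l : (y.val + 1) % m < m := Nat.mod_lt _ (by omega)
    have hadj : (SimpleGraph.cycleGraph m).Adj y ⟨(y.val + 1) % m, h1l⟩ := by
      rw [cycleGraph_adj_iff hm]
      generalize (y.val + 1) % m = e at *
      simp only
      omega
    obtain ⟨z, hz, hzy, x', hs', -⟩ := h.flip.exists_tight (fun b a hs => Or.inl (hT a b hs)) hs
      (hT _ _ hs) hadj
    refine ⟨x', z, ?_, hs'⟩
    rw [cycleGraph_adj_iff hm] at hz
    rw [Ne, Fin.ext_iff] at hzy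
    rw [hadd]
    have := z.isLt
    simp only at hz
    generalize (y.val + 1) % m = e at *
    omega
  have steps : ∀ c j : ℕ, (∃ x, ∃ y : Fin m, y.val = c % m ∧ S x y) →
      ∃ x, ∃ y : Fin m, y.val = (c + 2 * j) % m ∧ S x y := by
    intro c j hc
    induction j with
    | zero => exact hc
    | succ j ih => exact step _ ih
  -- as `m` is odd, moving by two columns generates all moves
  have all : ∀ d : ℕ, ∃ x, ∃ y : Fin m, y.val = (b.val + d) % m ∧ S x y := by
    intro d
    induction d with
    | zero => exact ⟨a, b, (Nat.mod_eq_of_lt b.isLt).symm, hS⟩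
    | succ d ih =>
      obtain ⟨e, rfl⟩ := hodd
      have := steps _ (e + 1) ih
      rwa [show b.val + d + 2 * (e + 1) = b.val + (d + 1) + (2 * e + 1) by ring,
        Nat.add_mod_right] at this
  obtain ⟨x, y, hy, hs⟩ := all (c.val + m - b.val)
  rw [show b.val + (c.val + m - b.val) = c.val + m by omega, Nat.add_mod_right,
    Nat.mod_eq_of_lt c.isLt] at hy
  exact ⟨x, Fin.ext hy ▸ hs⟩

/-- The basic bound is strict for the product of two paths. -/
theorem lt_of_path_path {n m : ℕ} (hn : 0 < n) (hm : 0 < m) (S : Finset (Fin n × Fin m)) {t : ℕ}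
    (ht : 2 ≤ t) (hS : observed ((SimpleGraph.pathGraph n).boxProd (SimpleGraph.pathGraph m))
      (S : Set (Fin n × Fin m)) t = Set.univ) : n * m < 4 * (S.card * t) := by
  obtain ⟨hle, heq⟩ := card_mul_card_le (degreeLeTwo_pathGraph n) (degreeLeTwo_pathGraph m) S ht hS
  simp only [Fintype.card_fin] at hle heq
  refine lt_of_le_of_ne hle fun he => ?_
  obtain ⟨F, hF, hT⟩ := heq he
  have hnm := Nat.mul_pos hn hm
  obtain ⟨⟨a, b⟩, hs⟩ := Finset.card_pos.1 (Nat.pos_of_mul_pos_right (show 0 < S.card * t by omega))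
  rcases hT a b hs with h | h
  · exact hF.not_tight_of_path hT _ a b rfl hs h
  · exact hF.flip.not_tight_of_path (fun b a hs => (hT a b hs).symm) _ b a rfl hs h

/-- In the case of equality for a path and an odd cycle, `S` meets every copy of the path. -/
theorem RoundTwo.exists_mem_column {n m : ℕ} (hm : 3 ≤ m) (hodd : Odd m)
    {S O F : Fin n → Fin m → Prop}
    (h : RoundTwo (SimpleGraph.pathGraph n) (SimpleGraph.cycleGraph m) S O F)
    (hT : ∀ a b, S a b → Tight (SimpleGraph.pathGraph n) (SimpleGraph.cycleGraph m) F a b ∨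
      Tight (SimpleGraph.cycleGraph m) (SimpleGraph.pathGraph n) (fun b a => F a b) b a)
    {a : Fin n} {b : Fin m} (hS : S a b) (c : Fin m) : ∃ x, S x c :=
  h.column_of_cycle hm hodd (fun a b hs => (hT a b hs).resolve_left
    (h.not_tight_of_path hT _ a b rfl hs)) hS c

/-- The basic bound is strict for the product of the path on four vertices and an odd cycle. -/
theorem lt_of_path_cycle {m : ℕ} (hm : 3 ≤ m) (hodd : Odd m) (S : Finset (Fin 4 × Fin m)) {t : ℕ}
    (ht : 2 ≤ t) (hS : observed ((SimpleGraph.pathGraph 4).boxProd (SimpleGraph.cycleGraph m))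
      (S : Set (Fin 4 × Fin m)) t = Set.univ) : 4 * m < 4 * (S.card * t) := by
  obtain ⟨hle, heq⟩ := card_mul_card_le (degreeLeTwo_pathGraph 4) (degreeLeTwo_cycleGraph hm)
    S ht hS
  simp only [Fintype.card_fin] at hle heq
  refine lt_of_le_of_ne hle fun he => ?_
  obtain ⟨F, hF, hT⟩ := heq he
  obtain ⟨⟨a, b⟩, hs⟩ := Finset.card_pos.1 (Nat.pos_of_mul_pos_right (show 0 < S.card * t by omega))
  have hcard : m ≤ S.card := by
    calc m = (Finset.univ : Finset (Fin m)).card := by simp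
      _ ≤ (S.image Prod.snd).card := Finset.card_le_card fun c _ => by
        obtain ⟨x, hx⟩ := hF.exists_mem_column hm hodd hT hs c
        exact Finset.mem_image.2 ⟨(x, c), hx, rfl⟩
      _ ≤ S.card := Finset.card_image_le
  have := Nat.mul_le_mul_left S.card ht
  omega

theorem lt_of_cycle_path {m : ℕ} (hm : 3 ≤ m) (hodd : Odd m) (S : Finset (Fin m × Fin 4)) {t : ℕ}
    (ht : 2 ≤ t) (hS : observed ((SimpleGraph.cycleGraph m).boxProd (SimpleGraph.pathGraph 4))
      (S : Set (Fin m × Fin 4)) t = Set.univ) : m * 4 < 4 * (S.card * t) := by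
  obtain ⟨hle, heq⟩ := card_mul_card_le (degreeLeTwo_cycleGraph hm) (degreeLeTwo_pathGraph 4)
    S ht hS
  simp only [Fintype.card_fin] at hle heq
  refine lt_of_le_of_ne hle fun he => ?_
  obtain ⟨F, hF, hT⟩ := heq he
  obtain ⟨⟨a, b⟩, hs⟩ := Finset.card_pos.1 (Nat.pos_of_mul_pos_right (show 0 < S.card * t by omega))
  have hcard : m ≤ S.card := by
    calc m = (Finset.univ : Finset (Fin m)).card := by simp
      _ ≤ (S.image Prod.fst).card := Finset.card_le_card fun c _ => by
        obtain ⟨x, hx⟩ := hF.flip.exists_mem_column hm hodd (fun b a hs => (hT a b hs).symm) hs c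
        exact Finset.mem_image.2 ⟨(c, x), hx, rfl⟩
      _ ≤ S.card := Finset.card_image_le
  have := Nat.mul_le_mul_left S.card ht
  omega

/-! ### Dominating sets in grids, cylinders and tori -/

/-- Adjacency of the numbers `i` and `j` as vertices of the path on `0, …, n - 1` if `c = false`,
and of the cycle if `c = true`. -/
def NatAdj (c : Bool) (n i j : ℕ) : Prop :=
  i + 1 = j ∨ j + 1 = i ∨ c = true ∧ (i = 0 ∧ j + 1 = n ∨ j = 0 ∧ i + 1 = n)

instance (c : Bool) (n i j : ℕ) : Decidable (NatAdj c n i j) :=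
  inferInstanceAs (Decidable (_ ∨ _))

/-- In the `n × m` grid, closed up to a cycle in the first and the second coordinate if `c` and `d`
are `true`, there is a dominating set of size at most `(n * m + r) / 4`. -/
def GridDom (c d : Bool) (n m r : ℕ) : Prop :=
  ∃ L : Finset (ℕ × ℕ), 4 * L.card ≤ n * m + r ∧ (∀ p ∈ L, p.1 < n ∧ p.2 < m) ∧
    ∀ i < n, ∀ j < m, ∃ p ∈ L, p.1 = i ∧ (p.2 = j ∨ NatAdj d m p.2 j) ∨
      NatAdj c n p.1 i ∧ p.2 = j

theorem NatAdj.mono {c c' : Bool} (hc : c = true → c' = true) {n i j : ℕ} (h : NatAdj c n i j) :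
    NatAdj c' n i j :=
  h.imp id (Or.imp id (And.imp hc id))

theorem GridDom.mono {c d c' d' : Bool} {n m r r' : ℕ} (h : GridDom c d n m r)
    (hc : c = true → c' = true) (hd : d = true → d' = true) (hr : r ≤ r') :
    GridDom c' d' n m r' := by
  obtain ⟨L, hL, hb, hdom⟩ := h
  refine ⟨L, by omega, hb, fun i hi j hj => ?_⟩
  obtain ⟨p, hp, h⟩ := hdom i hi j hj
  exact ⟨p, hp, h.imp (And.imp id (Or.imp id (NatAdj.mono hd))) (And.imp (NatAdj.mono hc) id)⟩

theorem GridDom.of_le {c d : Bool} {n m r r' : ℕ} (h : GridDom c d n m r) (hr : r ≤ r') :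
    GridDom c d n m r' :=
  h.mono id id hr

theorem GridDom.comm {c d : Bool} {n m r : ℕ} (h : GridDom c d n m r) : GridDom d c m n r := by
  obtain ⟨L, hL, hb, hdom⟩ := h
  refine ⟨L.image Prod.swap, ?_, ?_, fun i hi j hj => ?_⟩
  · rw [Finset.card_image_of_injective _ Prod.swap_injective, Nat.mul_comm m n]
    exact hL
  · intro p hp
    obtain ⟨q, hq, rfl⟩ := Finset.mem_image.1 hp
    exact (hb q hq).symm
  · obtain ⟨p, hp, h⟩ := hdom j hj i hi
    refine ⟨p.swap, Finset.mem_image_of_mem _ hp, ?_⟩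
    simp only [Prod.fst_swap, Prod.snd_swap]
    tauto

/-- Two grids with the same number of rows are dominated side by side. -/
theorem GridDom.append {n m m' r r' : ℕ} (h : GridDom false false n m r)
    (h' : GridDom false false n m' r') : GridDom false false n (m + m') (r + r') := by
  obtain ⟨L, hL, hb, hdom⟩ := h
  obtain ⟨L', hL', hb', hdom'⟩ := h'
  refine ⟨L ∪ L'.image (fun p => (p.1, m + p.2)), ?_, ?_, fun i hi j hj => ?_⟩
  · have h1 := Finset.card_union_le L (L'.image fun p => (p.1, m + p.2))
    have h2 : (L'.image fun p => (p.1, m + p.2)).card ≤ L'.card := Finset.card_image_le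
    rw [Nat.mul_add]
    omega
  · intro p hp
    rcases Finset.mem_union.1 hp with hp | hp
    · have := hb p hp
      omega
    · obtain ⟨q, hq, rfl⟩ := Finset.mem_image.1 hp
      have := hb' q hq
      simp only
      omega
  · rcases Nat.lt_or_ge j m with hjm | hjm
    · obtain ⟨p, hp, h⟩ := hdom i hi j hjm
      refine ⟨p, Finset.mem_union_left _ hp, ?_⟩
      simpa only [NatAdj, Bool.false_eq_true, false_and, or_false] using h
    · obtain ⟨p, hp, h⟩ := hdom' i hi (j - m) (by omega)
      refine ⟨_, Finset.mem_union_right _ (Finset.mem_image_of_mem _ hp), ?_⟩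
      simp only [NatAdj, Bool.false_eq_true, false_and, or_false] at h ⊢
      omega

/-- The cells `(i, j)` with `j` in the `i`-th list of `rows`. -/
def rowCells (rows : List (List ℕ)) : List (ℕ × ℕ) :=
  rows.zipIdx.flatMap fun r => r.1.map fun j => (r.2, j)

/-- The test that the cells of `rows` witness `GridDom c d n m r`. -/
def gridDomCheck (c d : Bool) (n m r : ℕ) (rows : List (List ℕ)) : Bool :=
  let l := rowCells rows
  decide (4 * l.length ≤ n * m + r) && l.all (fun p => decide (p.1 < n ∧ p.2 < m)) &&
    (List.range n).all fun i => (List.range m).all fun j => l.any fun p =>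
      decide (p.1 = i ∧ (p.2 = j ∨ NatAdj d m p.2 j) ∨ NatAdj c n p.1 i ∧ p.2 = j)

theorem gridDom_of_check {c d : Bool} {n m r : ℕ} (rows : List (List ℕ))
    (h : gridDomCheck c d n m r rows = true) : GridDom c d n m r := by
  simp only [gridDomCheck, Bool.and_eq_true, decide_eq_true_eq, List.all_eq_true, List.any_eq_true,
    List.mem_range] at h
  obtain ⟨⟨h1, h2⟩, h3⟩ := h
  refine ⟨(rowCells rows).toFinset, ?_, fun p hp => h2 p (List.mem_toFinset.1 hp),
    fun i hi j hj => ?_⟩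
  · have := List.toFinset_card_le (rowCells rows)
    omega
  · obtain ⟨p, hp, h⟩ := h3 i hi j hj
    exact ⟨p, List.mem_toFinset.2 hp, h⟩

/-! ### Explicit dominating sets -/

theorem gridDom_4_4 : GridDom false false 4 4 0 :=
  gridDom_of_check
    [[2], [0], [3], [1]]
    (by decide +kernel)

theorem gridDom_4_7 : GridDom false false 4 7 0 :=
  gridDom_of_check
    [[1, 5], [3], [0, 6], [2, 4]]
    (by decide +kernel)

theorem gridDom_4_10 : GridDom false false 4 10 0 :=
  gridDom_of_check
    [[2, 4, 8], [0, 6], [3, 9], [1, 5, 7]]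
    (by decide +kernel)

theorem gridDom_4_13 : GridDom false false 4 13 0 :=
  gridDom_of_check
    [[1, 5, 7, 11], [3, 9], [0, 6, 12], [2, 4, 8, 10]]
    (by decide +kernel)

theorem gridDom_5_5 : GridDom false false 5 5 3 :=
  gridDom_of_check
    [[0, 3], [3], [1], [4], [0, 2]]
    (by decide +kernel)

theorem gridDom_5_6 : GridDom false false 5 6 2 :=
  gridDom_of_check
    [[1, 4], [3], [0, 5], [2], [1, 4]]
    (by decide +kernel)

theorem gridDom_5_7 : GridDom false false 5 7 1 :=
  gridDom_of_check
    [[2, 5], [0, 5], [3], [1, 6], [1, 4]]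
    (by decide +kernel)

theorem gridDom_5_9 : GridDom false false 5 9 3 :=
  gridDom_of_check
    [[1, 4, 7], [2, 7], [0, 5], [3, 8], [1, 3, 6]]
    (by decide +kernel)

theorem gridDom_5_10 : GridDom false false 5 10 2 :=
  gridDom_of_check
    [[1, 5, 8], [3, 7], [0, 4, 9], [2, 6], [1, 4, 8]]
    (by decide +kernel)

theorem gridDom_5_11 : GridDom false false 5 11 1 :=
  gridDom_of_check
    [[1, 4, 6, 10], [2, 8], [0, 5, 10], [3, 7], [1, 5, 9]]
    (by decide +kernel)

theorem gridDom_5_15 : GridDom false false 5 15 1 :=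
  gridDom_of_check
    [[1, 5, 9, 13], [3, 7, 11], [0, 5, 9, 14], [2, 6, 12], [1, 4, 8, 10, 13]]
    (by decide +kernel)

theorem gridDom_5_16 : GridDom false false 5 16 0 :=
  gridDom_of_check
    [[1, 4, 6, 10, 14], [2, 8, 12], [0, 5, 10, 15], [3, 7, 13], [1, 5, 9, 11, 15]]
    (by decide +kernel)

theorem gridDom_5_19 : GridDom false false 5 19 1 :=
  gridDom_of_check
    [[1, 5, 9, 13, 17], [3, 7, 11, 15], [0, 5, 13, 18], [2, 8, 9, 10, 16], [0, 4, 6, 12, 14,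
      18]]
    (by decide +kernel)

theorem gridDom_5_20 : GridDom false false 5 20 0 :=
  gridDom_of_check
    [[1, 5, 9, 11, 15, 19], [3, 7, 13, 17], [0, 5, 10, 14, 19], [2, 8, 12, 16], [0, 4, 6, 10,
      14, 18]]
    (by decide +kernel)

theorem gridDom_5_24 : GridDom false false 5 24 0 :=
  gridDom_of_check
    [[1, 4, 8, 12, 14, 18, 22], [6, 10, 16, 20], [0, 2, 3, 8, 13, 18, 23], [5, 11, 15, 21], [1,
      4, 7, 9, 13, 17, 19, 23]]
    (by decide +kernel)

theorem gridDom_5_28 : GridDom false false 5 28 0 :=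
  gridDom_of_check
    [[1, 5, 8, 12, 16, 18, 22, 26], [3, 8, 10, 14, 20, 24], [0, 3, 6, 12, 17, 22, 27], [3, 9,
      15, 19, 25], [1, 5, 7, 11, 13, 17, 21, 23, 27]]
    (by decide +kernel)

theorem gridDom_6_7 : GridDom false false 6 7 2 :=
  gridDom_of_check
    [[1, 5], [3], [0, 6], [2, 4], [2, 6], [0, 4]]
    (by decide +kernel)

theorem gridDom_6_8 : GridDom false false 6 8 0 :=
  gridDom_of_check
    [[2, 6], [0, 4], [2, 7], [0, 5], [3, 7], [1, 5]]
    (by decide +kernel)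

theorem gridDom_6_9 : GridDom false false 6 9 2 :=
  gridDom_of_check
    [[2, 6], [0, 4, 8], [1, 6], [3, 7], [0, 5], [2, 5, 8]]
    (by decide +kernel)

theorem gridDom_6_11 : GridDom false false 6 11 2 :=
  gridDom_of_check
    [[2, 6, 9], [0, 4], [2, 7, 8, 10], [0, 5], [3, 7, 9], [1, 5, 9]]
    (by decide +kernel)

theorem gridDom_6_12 : GridDom false false 6 12 0 :=
  gridDom_of_check
    [[1, 5, 9], [3, 7, 11], [0, 5, 9], [2, 7, 11], [0, 4, 8], [2, 6, 10]]
    (by decide +kernel)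

theorem gridDom_6_14 : GridDom false false 6 14 0 :=
  gridDom_of_check
    [[0, 4, 7, 11], [2, 7, 9, 13], [1, 5, 11], [3, 8, 13], [0, 6, 10], [2, 4, 8, 12]]
    (by decide +kernel)

theorem gridDom_6_18 : GridDom false false 6 18 0 :=
  gridDom_of_check
    [[2, 6, 10, 13, 17], [0, 4, 8, 10, 15], [2, 6, 12, 17], [0, 4, 9, 14], [3, 7, 11, 16], [1,
      5, 9, 13, 16]]
    (by decide +kernel)

theorem gridDom_7_7 : GridDom false false 7 7 0 :=
  gridDom_of_check
    [[2, 4], [0, 6], [3], [1, 5], [3], [0, 6], [2, 4]]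
    (by decide +kernel)

theorem gridDom_9_8 : GridDom false false 9 8 0 :=
  gridDom_of_check
    [[2, 6], [0, 4], [2, 7], [0, 5], [3, 6], [1, 6], [4], [0, 2, 7], [2, 5]]
    (by decide +kernel)

theorem gridDom_9_9 : GridDom false false 9 9 0 :=
  gridDom_of_check
    [[1, 3, 7], [5], [0, 2, 7, 8], [4], [1, 6], [3, 8], [0, 5], [2, 7], [1, 4, 7]]
    (by decide +kernel)

theorem gridDom_9_12 : GridDom false false 9 12 0 :=
  gridDom_of_check
    [[2, 6, 8], [0, 4, 10, 11], [3, 5, 7], [1, 9], [0, 4, 6, 11], [2, 8], [0, 5, 10], [3, 7,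
      11], [1, 5, 9]]
    (by decide +kernel)

theorem gridDom_10_10 : GridDom false false 10 10 0 :=
  gridDom_of_check
    [[1, 4, 8], [1, 6], [3, 7, 9], [0, 5], [2, 8], [0, 4, 6], [2, 8, 9], [0, 5], [3, 7], [1, 5,
      9]]
    (by decide +kernel)

theorem gridDom_4_5 : GridDom false false 4 5 4 :=
  gridDom_of_check
    [[3], [0, 1], [4], [0, 2]]
    (by decide +kernel)

theorem gridDom_4_6 : GridDom false false 4 6 4 :=
  gridDom_of_check
    [[2, 4], [0, 2], [5], [1, 3]]
    (by decide +kernel)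

theorem gridDom_4_9 : GridDom false false 4 9 4 :=
  gridDom_of_check
    [[2, 7], [0, 4, 5], [3, 8], [1, 3, 6]]
    (by decide +kernel)

theorem gridDom_5_8 : GridDom false false 5 8 4 :=
  gridDom_of_check
    [[1, 3, 6], [], [0, 2, 4, 5, 7], [], [1, 3, 6]]
    (by decide +kernel)

theorem gridDom_5_12 : GridDom false false 5 12 4 :=
  gridDom_of_check
    [[1, 4, 6, 10], [3, 8], [0, 5, 11], [2, 7, 9], [0, 4, 7, 11]]
    (by decide +kernel)

theorem gridDom_6_6 : GridDom false false 6 6 4 :=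
  gridDom_of_check
    [[2], [0, 4, 5], [], [1, 2, 3], [5], [0, 3]]
    (by decide +kernel)

theorem gridDom_6_10 : GridDom false false 6 10 4 :=
  gridDom_of_check
    [[1, 4, 5, 9], [2, 7], [0, 5, 7], [3, 9], [1, 6], [1, 4, 8]]
    (by decide +kernel)

theorem gridDom_4_5_cycle_path : GridDom true false 4 5 0 :=
  gridDom_of_check
    [[3], [0, 2], [4], [1]]
    (by decide +kernel)

theorem gridDom_4_6_cycle_path : GridDom true false 4 6 0 :=
  gridDom_of_check
    [[1, 3, 5], [], [0, 2, 4], []]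
    (by decide +kernel)

theorem gridDom_4_9_cycle_path : GridDom true false 4 9 0 :=
  gridDom_of_check
    [[3, 7], [0, 5], [2, 6, 8], [1, 4]]
    (by decide +kernel)

theorem gridDom_5_8_cycle_path : GridDom true false 5 8 0 :=
  gridDom_of_check
    [[1, 6], [1, 3], [5, 7], [0, 2, 7], [4]]
    (by decide +kernel)

theorem gridDom_5_12_cycle_path : GridDom true false 5 12 0 :=
  gridDom_of_check
    [[1, 6, 11], [4, 9], [0, 2, 7], [0, 3, 5, 10, 11], [3, 8]]
    (by decide +kernel)

theorem gridDom_6_6_cycle_path : GridDom true false 6 6 0 :=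
  gridDom_of_check
    [[0, 5], [3], [1, 5], [2], [0, 4], [2]]
    (by decide +kernel)

theorem gridDom_6_10_cycle_path : GridDom true false 6 10 0 :=
  gridDom_of_check
    [[0, 6], [3, 8], [1, 5, 7], [3, 5, 9], [0, 7], [2, 4, 9]]
    (by decide +kernel)

theorem gridDom_4_6_path_cycle : GridDom false true 4 6 0 :=
  gridDom_of_check
    [[0, 4], [2], [5], [1, 3]]
    (by decide +kernel)

theorem gridDom_5_8_path_cycle : GridDom false true 5 8 0 :=
  gridDom_of_check
    [[0, 4], [2, 6], [0, 3], [1, 5], [3, 7]]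
    (by decide +kernel)

theorem gridDom_5_12_path_cycle : GridDom false true 5 12 0 :=
  gridDom_of_check
    [[1, 5, 9], [3, 7, 11], [1, 5, 8], [2, 6, 10], [0, 4, 8]]
    (by decide +kernel)

theorem gridDom_6_10_path_cycle : GridDom false true 6 10 0 :=
  gridDom_of_check
    [[3, 7, 9], [1, 5], [1, 5, 8], [3, 8], [0, 6], [2, 4, 8]]
    (by decide +kernel)

/-! ### Dominating sets for all side lengths -/

/-- The numbers `n` of rows for which the `n × 4` grid has a dominating set of size at most `n`,
that is, a quarter of its vertices; see `gridDom_four`. -/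
def IsBlockHeight (n : ℕ) : Prop := n = 4 ∨ n = 7 ∨ n = 8 ∨ 10 ≤ n

theorem gridDom_four (n : ℕ) (hn : IsBlockHeight n) : GridDom false false 4 n 0 := by
  induction n using Nat.strong_induction_on with
  | _ n ih =>
    unfold IsBlockHeight at hn ih
    by_cases h : n = 4 ∨ n = 7 ∨ n = 10 ∨ n = 13
    · rcases h with rfl | rfl | rfl | rfl
      · exact gridDom_4_4
      · exact gridDom_4_7
      · exact gridDom_4_10
      · exact gridDom_4_13
    · have := (ih (n - 4) (by omega) (by omega)).append gridDom_4_4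
      rwa [show n - 4 + 4 = n by omega] at this

theorem GridDom.add_fours {n m r : ℕ} (hn : IsBlockHeight n) (h : GridDom false false n m r)
    (k : ℕ) : GridDom false false n (m + 4 * k) r := by
  induction k with
  | zero => exact h
  | succ k ih => exact ih.append (gridDom_four n hn).comm

theorem gridDom_of_four_dvd {n k : ℕ} (hn : IsBlockHeight n) (hk : 1 ≤ k) :
    GridDom false false n (4 * k) 0 := by
  have := (gridDom_four n hn).comm.add_fours hn (k - 1)
  rwa [show 4 + 4 * (k - 1) = 4 * k by omega] at this

/-- Blocks of size `5 × 16` with 20 vertices are appended to the small cases, one for each residue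
modulo 16. -/
theorem gridDom_five (m : ℕ) (hm : 5 ≤ m) (h8 : m ≠ 8) (h12 : m ≠ 12) :
    GridDom false false 5 m 3 := by
  induction m using Nat.strong_induction_on with
  | _ m ih =>
    by_cases h : m ≤ 20 ∨ m = 24 ∨ m = 28
    · have : m = 5 ∨ m = 6 ∨ m = 7 ∨ m = 9 ∨ m = 10 ∨ m = 11 ∨ m = 13 ∨ m = 14 ∨ m = 15 ∨ m = 16 ∨
          m = 17 ∨ m = 18 ∨ m = 19 ∨ m = 20 ∨ m = 24 ∨ m = 28 := by omega
      rcases this with rfl | rfl | rfl | rfl | rfl | rfl | rfl | rfl | rfl | rfl | rfl | rfl | rfl |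
        rfl | rfl | rfl
      · exact gridDom_5_5.of_le (by omega)
      · exact gridDom_5_6.of_le (by omega)
      · exact gridDom_5_7.of_le (by omega)
      · exact gridDom_5_9.of_le (by omega)
      · exact gridDom_5_10.of_le (by omega)
      · exact gridDom_5_11.of_le (by omega)
      · exact (gridDom_5_6.append gridDom_5_7).of_le (by omega)
      · exact (gridDom_5_7.append gridDom_5_7).of_le (by omega)
      · exact gridDom_5_15.of_le (by omega)
      · exact gridDom_5_16.of_le (by omega)
      · exact (gridDom_5_6.append gridDom_5_11).of_le (by omega)
      · exact (gridDom_5_7.append gridDom_5_11).of_le (by omega)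
      · exact gridDom_5_19.of_le (by omega)
      · exact gridDom_5_20.of_le (by omega)
      · exact gridDom_5_24.of_le (by omega)
      · exact gridDom_5_28.of_le (by omega)
    · have := (ih (m - 16) (by omega) (by omega) (by omega) (by omega)).append gridDom_5_16
      rwa [show m - 16 + 16 = m by omega] at this

/-- Blocks of size `6 × 8` with 12 vertices are appended to the small cases, one for each residue
modulo 8. -/
theorem gridDom_six (m : ℕ) (hm : 5 ≤ m) (h6 : m ≠ 6) (h10 : m ≠ 10) :
    GridDom false false 6 m 3 := by
  induction m using Nat.strong_induction_on with
  | _ m ih =>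
    by_cases h : m ≤ 12 ∨ m = 14 ∨ m = 18
    · have : m = 5 ∨ m = 7 ∨ m = 8 ∨ m = 9 ∨ m = 11 ∨ m = 12 ∨ m = 14 ∨ m = 18 := by omega
      rcases this with rfl | rfl | rfl | rfl | rfl | rfl | rfl | rfl
      · exact gridDom_5_6.comm.of_le (by omega)
      · exact gridDom_6_7.of_le (by omega)
      · exact gridDom_6_8.of_le (by omega)
      · exact gridDom_6_9.of_le (by omega)
      · exact gridDom_6_11.of_le (by omega)
      · exact gridDom_6_12.of_le (by omega)
      · exact gridDom_6_14.of_le (by omega)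
      · exact gridDom_6_18.of_le (by omega)
    · have := (ih (m - 8) (by omega) (by omega) (by omega) (by omega)).append gridDom_6_8
      rwa [show m - 8 + 8 = m by omega] at this

theorem gridDom_seven (m : ℕ) (hm : 4 ≤ m) : GridDom false false 7 m 3 := by
  have h7 : IsBlockHeight 7 := by simp [IsBlockHeight]
  have base : ∀ k, 4 ≤ k → k < 8 → GridDom false false 7 k 3 := by
    intro k hk hk'
    have : k = 4 ∨ k = 5 ∨ k = 6 ∨ k = 7 := by omega
    rcases this with rfl | rfl | rfl | rfl
    · exact gridDom_4_7.comm.of_le (by omega)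
    · exact gridDom_5_7.comm.of_le (by omega)
    · exact gridDom_6_7.comm.of_le (by omega)
    · exact gridDom_7_7.of_le (by omega)
  have := (base (4 + m % 4) (by omega) (by omega)).add_fours h7 ((m - 4) / 4)
  rwa [show 4 + m % 4 + 4 * ((m - 4) / 4) = m by omega] at this

theorem gridDom_nine (m : ℕ) (hm : 5 ≤ m) : GridDom false false 9 m 3 := by
  rcases Nat.lt_or_ge m 10 with h | h
  · have : m = 5 ∨ m = 6 ∨ m = 7 ∨ m = 8 ∨ m = 9 := by omega
    rcases this with rfl | rfl | rfl | rfl | rfl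
    · exact (gridDom_five 9 (by omega) (by omega) (by omega)).comm
    · exact (gridDom_six 9 (by omega) (by omega) (by omega)).comm
    · exact (gridDom_seven 9 (by omega)).comm
    · exact gridDom_9_8.of_le (by omega)
    · exact gridDom_9_9.of_le (by omega)
  · by_cases h12 : m = 12
    · subst h12
      exact gridDom_9_12.of_le (by omega)
    · exact ((gridDom_five m hm (by omega) h12).comm.add_fours
        (by unfold IsBlockHeight; omega) 1).comm

/-- Appending `n × 4` blocks changes `m` by multiples of 4, so it suffices to treat one `m` in each
residue class. -/
theorem gridDom_of_isBlockHeight {n m : ℕ} (hn : IsBlockHeight n) (hm : IsBlockHeight m) :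
    GridDom false false n m 3 := by
  have four : ∀ {n m : ℕ}, IsBlockHeight n → IsBlockHeight m → m % 4 = 0 →
      GridDom false false n m 3 := by
    intro n m hn hm h
    have := gridDom_of_four_dvd hn (k := m / 4) (by unfold IsBlockHeight at hm; omega)
    rw [show 4 * (m / 4) = m by omega] at this
    exact this.of_le (by omega)
  have add : ∀ k, k ≤ m → (m - k) % 4 = 0 → GridDom false false n k 3 →
      GridDom false false n m 3 := by
    intro k hk h4 h
    have := h.add_fours hn ((m - k) / 4)
    rwa [show k + 4 * ((m - k) / 4) = m by omega] at this
  by_cases hm0 : m % 4 = 0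
  · exact four hn hm hm0
  by_cases hn0 : n % 4 = 0
  · exact (four hm hn hn0).comm
  unfold IsBlockHeight at hn hm
  by_cases hm3 : m % 4 = 3
  · exact add 7 (by omega) (by omega) (gridDom_seven n (by omega)).comm
  by_cases hm1 : m % 4 = 1
  · exact add 5 (by omega) (by omega) (gridDom_five n (by omega) (by omega) (by omega)).comm
  by_cases hn10 : n = 10
  · subst hn10
    exact add 10 (by omega) (by omega) (gridDom_10_10.of_le (by omega))
  · exact add 6 (by omega) (by omega) (gridDom_six n (by omega) (by omega) hn10).comm

/-- The side lengths, shorter one first, for which the dominating set given here for the product of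
two paths has `n * m / 4 + 1` vertices. -/
def IsExceptional (n m : ℕ) : Prop :=
  n = 4 ∧ (m = 5 ∨ m = 6 ∨ m = 9) ∨ n = 5 ∧ (m = 8 ∨ m = 12) ∨ n = 6 ∧ (m = 6 ∨ m = 10)

theorem gridDom_of_not_isExceptional {n m : ℕ} (hn : 4 ≤ n) (hm : 4 ≤ m)
    (h : ¬ IsExceptional n m) (h' : ¬ IsExceptional m n) : GridDom false false n m 3 := by
  unfold IsExceptional at h h'
  by_cases h5 : n = 5
  · subst h5; exact gridDom_five m (by omega) (by omega) (by omega)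
  by_cases h6 : n = 6
  · subst h6; exact gridDom_six m (by omega) (by omega) (by omega)
  by_cases h9 : n = 9
  · subst h9; exact gridDom_nine m (by omega)
  by_cases h5' : m = 5
  · subst h5'; exact (gridDom_five n (by omega) (by omega) (by omega)).comm
  by_cases h6' : m = 6
  · subst h6'; exact (gridDom_six n (by omega) (by omega) (by omega)).comm
  by_cases h9' : m = 9
  · subst h9'; exact (gridDom_nine n (by omega)).comm
  exact gridDom_of_isBlockHeight (by unfold IsBlockHeight; omega) (by unfold IsBlockHeight; omega)

theorem IsExceptional.gridDom_path_path {n m : ℕ} (h : IsExceptional n m) :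
    GridDom false false n m 4 := by
  rcases h with ⟨rfl, rfl | rfl | rfl⟩ | ⟨rfl, rfl | rfl⟩ | ⟨rfl, rfl | rfl⟩
  · exact gridDom_4_5
  · exact gridDom_4_6
  · exact gridDom_4_9
  · exact gridDom_5_8
  · exact gridDom_5_12
  · exact gridDom_6_6
  · exact gridDom_6_10

theorem IsExceptional.gridDom_cycle_path {n m : ℕ} (h : IsExceptional n m) :
    GridDom true false n m 0 := by
  rcases h with ⟨rfl, rfl | rfl | rfl⟩ | ⟨rfl, rfl | rfl⟩ | ⟨rfl, rfl | rfl⟩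
  · exact gridDom_4_5_cycle_path
  · exact gridDom_4_6_cycle_path
  · exact gridDom_4_9_cycle_path
  · exact gridDom_5_8_cycle_path
  · exact gridDom_5_12_cycle_path
  · exact gridDom_6_6_cycle_path
  · exact gridDom_6_10_cycle_path

theorem IsExceptional.gridDom_path_cycle {n m : ℕ} (h : IsExceptional n m)
    (hodd : ¬ (n = 4 ∧ Odd m)) : GridDom false true n m 0 := by
  rcases h with ⟨rfl, rfl | rfl | rfl⟩ | ⟨rfl, rfl | rfl⟩ | ⟨rfl, rfl | rfl⟩
  · exact absurd ⟨rfl, by decide⟩ hodd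
  · exact gridDom_4_6_path_cycle
  · exact absurd ⟨rfl, by decide⟩ hodd
  · exact gridDom_5_8_path_cycle
  · exact gridDom_5_12_path_cycle
  · exact gridDom_6_6_cycle_path.comm
  · exact gridDom_6_10_path_cycle

theorem gridDom_path_path {n m : ℕ} (hn : 4 ≤ n) (hm : 4 ≤ m) : GridDom false false n m 4 := by
  by_cases h : IsExceptional n m
  · exact h.gridDom_path_path
  by_cases h' : IsExceptional m n
  · exact h'.gridDom_path_path.comm
  exact (gridDom_of_not_isExceptional hn hm h h').of_le (by omega)

theorem gridDom_path_cycle {n m : ℕ} (hn : 4 ≤ n) (hm : 4 ≤ m) (hodd : ¬ (n = 4 ∧ Odd m)) :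
    GridDom false true n m 3 := by
  by_cases h : IsExceptional n m
  · exact (h.gridDom_path_cycle hodd).of_le (by omega)
  by_cases h' : IsExceptional m n
  · exact h'.gridDom_cycle_path.comm.of_le (by omega)
  exact (gridDom_of_not_isExceptional hn hm h h').mono id (by simp) le_rfl

theorem gridDom_cycle_cycle {n m : ℕ} (hn : 4 ≤ n) (hm : 4 ≤ m) : GridDom true true n m 3 := by
  by_cases h : IsExceptional n m
  · exact h.gridDom_cycle_path.mono id (by simp) (by omega)
  by_cases h' : IsExceptional m n
  · exact h'.gridDom_cycle_path.comm.mono (by simp) id (by omega)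
  exact (gridDom_of_not_isExceptional hn hm h h').mono (by simp) (by simp) le_rfl

/-! ### Throttling and domination numbers -/

theorem GridDom.four_mul_dominationNumber_le {c d : Bool} {n m r : ℕ} (h : GridDom c d n m r)
    {J : SimpleGraph (Fin n)} {K : SimpleGraph (Fin m)}
    (hJ : ∀ u v : Fin n, NatAdj c n u v → J.Adj u v)
    (hK : ∀ u v : Fin m, NatAdj d m u v → K.Adj u v) :
    4 * dominationNumber (J.boxProd K) ≤ n * m + r := by
  obtain ⟨L, hL, hb, hdom⟩ := h
  let S : Finset (Fin n × Fin m) := Finset.univ.filter fun u => (u.1.val, u.2.val) ∈ L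
  have hS : IsDominatingSet (J.boxProd K) S := by
    refine Set.eq_univ_of_forall fun u => ?_
    obtain ⟨p, hp, h⟩ := hdom u.1 u.1.isLt u.2 u.2.isLt
    let q : Fin n × Fin m := (⟨p.1, (hb p hp).1⟩, ⟨p.2, (hb p hp).2⟩)
    have hq : q ∈ S := by simpa [S, q] using hp
    rcases h with ⟨h1, h2 | h2⟩ | ⟨h1, h2⟩
    · have : q = u := Prod.ext (Fin.ext h1) (Fin.ext h2)
      exact Or.inl (this ▸ hq)
    · exact Or.inr ⟨q, hq, SimpleGraph.boxProd_adj.2 (Or.inr ⟨hK q.2 u.2 h2, Fin.ext h1⟩)⟩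
    · exact Or.inr ⟨q, hq, SimpleGraph.boxProd_adj.2 (Or.inl ⟨hJ q.1 u.1 h1, Fin.ext h2⟩)⟩
  have h1 : dominationNumber (J.boxProd K) ≤ S.card := Nat.sInf_le ⟨S, hS, rfl⟩
  have h2 : S.card ≤ L.card := Finset.card_le_card_of_injOn (fun u => (u.1.val, u.2.val))
    (fun u hu => by simpa [S] using hu) fun u _ v _ e => by
      simp only [Prod.mk.injEq] at e
      exact Prod.ext (Fin.ext e.1) (Fin.ext e.2)
  omega

theorem pathGraph_adj_of_natAdj {n : ℕ} (u v : Fin n) (h : NatAdj false n u v) :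
    (SimpleGraph.pathGraph n).Adj u v := by
  simpa [NatAdj, pathGraph_adj_iff] using h

theorem cycleGraph_adj_of_natAdj {n : ℕ} (hn : 3 ≤ n) (u v : Fin n) (h : NatAdj true n u v) :
    (SimpleGraph.cycleGraph n).Adj u v := by
  simpa [NatAdj, cycleGraph_adj_iff hn] using h

/-- A set that observes everything in `t ≥ 2` rounds satisfies `γ(G) ≤ |S| * t`. -/
theorem dominationNumber_le_card_mul {n m : ℕ} (hn : 4 ≤ n) (hm : 4 ≤ m)
    {J : SimpleGraph (Fin n)} (hJ : J = SimpleGraph.pathGraph n ∨ J = SimpleGraph.cycleGraph n)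
    {K : SimpleGraph (Fin m)} (hK : K = SimpleGraph.pathGraph m ∨ K = SimpleGraph.cycleGraph m)
    (S : Finset (Fin n × Fin m)) {t : ℕ} (ht : 2 ≤ t)
    (hS : observed (J.boxProd K) (S : Set (Fin n × Fin m)) t = Set.univ) :
    dominationNumber (J.boxProd K) ≤ S.card * t := by
  have hn3 : 3 ≤ n := by omega
  have hm3 : 3 ≤ m := by omega
  rcases hJ with rfl | rfl <;> rcases hK with rfl | rfl
  · have h1 := lt_of_path_path (by omega) (by omega) S ht hS
    have h2 := (gridDom_path_path hn hm).four_mul_dominationNumber_le pathGraph_adj_of_natAdj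
      pathGraph_adj_of_natAdj
    omega
  · by_cases hodd : n = 4 ∧ Odd m
    · obtain ⟨rfl, hodd⟩ := hodd
      have h1 := lt_of_path_cycle hm3 hodd S ht hS
      have h2 := ((gridDom_path_path hn hm).mono (d' := true) id (by simp)
        le_rfl).four_mul_dominationNumber_le pathGraph_adj_of_natAdj (cycleGraph_adj_of_natAdj hm3)
      omega
    · have h1 := (card_mul_card_le (degreeLeTwo_pathGraph n) (degreeLeTwo_cycleGraph hm3) S ht hS).1
      have h2 := (gridDom_path_cycle hn hm hodd).four_mul_dominationNumber_le
        pathGraph_adj_of_natAdj (cycleGraph_adj_of_natAdj hm3)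
      simp only [Fintype.card_fin] at h1
      omega
  · by_cases hodd : m = 4 ∧ Odd n
    · obtain ⟨rfl, hodd⟩ := hodd
      have h1 := lt_of_cycle_path hn3 hodd S ht hS
      have h2 := ((gridDom_path_path hn hm).mono (c' := true) (by simp) id
        le_rfl).four_mul_dominationNumber_le (cycleGraph_adj_of_natAdj hn3) pathGraph_adj_of_natAdj
      omega
    · have h1 := (card_mul_card_le (degreeLeTwo_cycleGraph hn3) (degreeLeTwo_pathGraph m) S ht hS).1
      have h2 := (gridDom_path_cycle hm hn hodd).comm.four_mul_dominationNumber_le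
        (cycleGraph_adj_of_natAdj hn3) pathGraph_adj_of_natAdj
      simp only [Fintype.card_fin] at h1
      omega
  · have h1 := (card_mul_card_le (degreeLeTwo_cycleGraph hn3) (degreeLeTwo_cycleGraph hm3)
      S ht hS).1
    have h2 := (gridDom_cycle_cycle hn hm).four_mul_dominationNumber_le
      (cycleGraph_adj_of_natAdj hn3) (cycleGraph_adj_of_natAdj hm3)
    simp only [Fintype.card_fin] at h1
    omega

/-- The nonemptiness of `S` matters when no `t` exists: then the propagation time is `⊤`, and the
product is `⊤` only because `|S| ≠ 0`. -/
theorem le_productPowerThrottlingOf {V : Type*} [Finite V] {G : SimpleGraph V} {S : Finset V}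
    (hS : S.Nonempty) {g : ℕ}
    (h : ∀ t, 1 ≤ t → observed G (S : Set V) t = Set.univ → g ≤ S.card * t) :
    (g : ℕ∞) ≤ productPowerThrottlingOf G S := by
  classical
  unfold productPowerThrottlingOf
  by_cases hex : ∃ t, 1 ≤ t ∧ observed G (S : Set V) t = Set.univ
  · have hle : ((Nat.find hex : ℕ) : ℕ∞) ≤ powerPropagationTime G S :=
      le_iInf₂ fun t ht => Nat.cast_le.2 (Nat.find_min' hex ht)
    calc (g : ℕ∞) ≤ ((S.card * Nat.find hex : ℕ) : ℕ∞) :=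
          Nat.cast_le.2 (h _ (Nat.find_spec hex).1 (Nat.find_spec hex).2)
      _ = (S.card : ℕ∞) * (Nat.find hex : ℕ) := Nat.cast_mul _ _
      _ ≤ _ := by gcongr
  · have htop : powerPropagationTime G S = ⊤ := by
      unfold powerPropagationTime
      refine iInf₂_eq_top.2 fun t ht => absurd ⟨t, ht⟩ hex
    rw [htop, ENat.mul_top (by exact_mod_cast hS.card_pos.ne')]
    exact le_top

theorem observed_empty {V : Type*} (G : SimpleGraph V) (i : ℕ) : observed G ∅ i = ∅ := by
  have h1 : observed G ∅ 1 = ∅ := by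
    ext v
    simp [observed, closedNeighborhood]
  rcases Nat.eq_zero_or_pos i with rfl | hi
  · rfl
  · induction i, hi using Nat.le_induction with
    | base => exact h1
    | succ i hi ih =>
      rw [observed_succ G ∅ hi, ih]
      ext v
      simp [forcedVertices]

theorem IsPowerDominatingSet.nonempty {V : Type*} [Nonempty V] {G : SimpleGraph V} {S : Finset V}
    (h : IsPowerDominatingSet G S) : S.Nonempty := by
  rw [Finset.nonempty_iff_ne_empty]
  rintro rfl
  obtain ⟨i, hi⟩ := h (Classical.arbitrary V)
  rw [Finset.coe_empty, observed_empty] at hi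
  exact hi

theorem productPowerThrottlingNumber_le_dominationNumber {V : Type*} [Finite V] [Nonempty V]
    (G : SimpleGraph V) : productPowerThrottlingNumber G ≤ (dominationNumber G : ℕ∞) := by
  classical
  have := Fintype.ofFinite V
  have hne : {k : ℕ | ∃ S : Finset V, IsDominatingSet G S ∧ S.card = k}.Nonempty :=
    ⟨_, Finset.univ, Set.eq_univ_of_forall fun v => Or.inl (by simp), rfl⟩
  obtain ⟨S, hS, hcard⟩ := Nat.sInf_mem hne
  have hpds : IsPowerDominatingSet G S := fun v => ⟨1, Set.eq_univ_iff_forall.1 hS v⟩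
  have ht : powerPropagationTime G S ≤ 1 := iInf₂_le 1 ⟨le_rfl, hS⟩
  calc productPowerThrottlingNumber G ≤ productPowerThrottlingOf G S := iInf₂_le S hpds.nonempty
    _ ≤ (S.card : ℕ∞) * 1 := by unfold productPowerThrottlingOf; gcongr
    _ = (dominationNumber G : ℕ∞) := by rw [mul_one, hcard]; rfl

theorem mainTheorem2 (n m : ℕ) (hn : 4 ≤ n) (hm : 4 ≤ m)
    (J : SimpleGraph (Fin n)) (hJ : J = SimpleGraph.pathGraph n ∨ J = SimpleGraph.cycleGraph n)
    (K : SimpleGraph (Fin m)) (hK : K = SimpleGraph.pathGraph m ∨ K = SimpleGraph.cycleGraph m) :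
    (∀ S : Finset (Fin n × Fin m),
      IsPowerDominatingSet (SimpleGraph.boxProd J K) S →
      ¬ IsDominatingSet (SimpleGraph.boxProd J K) S →
      ((⌈((n : ℚ) * (m : ℚ)) / 4⌉₊ : ℕ) : ℕ∞)
        ≤ productPowerThrottlingOf (SimpleGraph.boxProd J K) S) ∧
    productPowerThrottlingNumber (SimpleGraph.boxProd J K)
      = (dominationNumber (SimpleGraph.boxProd J K) : ℕ∞) := by
  have hne : Nonempty (Fin n × Fin m) := ⟨(⟨0, by omega⟩, ⟨0, by omega⟩)⟩
  have hJ2 : DegreeLeTwo J := by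
    rcases hJ with rfl | rfl
    · exact degreeLeTwo_pathGraph n
    · exact degreeLeTwo_cycleGraph (by omega)
  have hK2 : DegreeLeTwo K := by
    rcases hK with rfl | rfl
    · exact degreeLeTwo_pathGraph m
    · exact degreeLeTwo_cycleGraph (by omega)
  refine ⟨fun S hS hdom => le_productPowerThrottlingOf hS.nonempty fun t ht htS => ?_,
    le_antisymm (productPowerThrottlingNumber_le_dominationNumber _)
      (le_iInf₂ fun S hS => le_productPowerThrottlingOf hS fun t ht htS => ?_)⟩
  · rcases ht.eq_or_lt with rfl | ht
    · exact absurd htS hdom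
    · have h := (card_mul_card_le hJ2 hK2 S ht htS).1
      simp only [Fintype.card_fin] at h
      rw [Nat.ceil_le, div_le_iff₀ (by norm_num)]
      rw [mul_comm 4] at h
      exact_mod_cast h
  · rcases ht.eq_or_lt with rfl | ht
    · rw [mul_one]
      exact Nat.sInf_le ⟨S, htS, rfl⟩
    · exact dominationNumber_le_card_mul hn hm hJ hK S ht htS
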